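/- Let $K$ be a field, let $E=(E^0,E^1,r,s)$ be an arbitrary directed graph (any sets of vertices and edges), and let $L=L_K(E)$ be its Leavitt path algebra: the associative, not necessarily unital $K$-algebra generated by pairwise orthogonal idempotents $v\in E^0$ and elements $e,e^*$ ($e\in E^1$) with $s(e)e=e=er(e)$, $r(e)e^*=e^*=e^*s(e)$, $e^*e=r(e)$, $e^*f=0$ for edges $e\neq f$, and $v=\sum_{s(e)=v}ee^*$ for every vertex $v$ that emits a nonempty finite set of edges. It is $\mathbb Z$-graded, $L_n$ being the span of the elements $\alpha\beta^*$ with $\alpha,\beta$ paths and $|\alpha|-|\beta|=n$, where $|\cdot|$ denotes length. The graded socle $Soc^{gr}(L)$ is the sum of all minimal graded left ideals of $L$. For $v\in E^0$ let $T(v)$ be the set of all vertices $w$ such that there is a path (of length $\ge 0$) from $v$ to $w$. A cycle is a closed path of positive length $e_1\cdots e_n$ whose edges have pairwise distinct sources, and it has no exit if each $e_i$ is the only edge emitted by $s(e_i)$. A vertex $v$ is a line point if no vertex of $T(v)$ emits more than one edge or is the base of a cycle. It is a Laurent vertex if $T(v)$ is the set of the vertices on a single path $\mu c$, where $\mu$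 is a path starting at $v$ without bifurcations (no vertex on it emits more than one edge) and $c$ is a cycle without exits based at $r(\mu)$. For a set $\Lambda$, a $\mathbb Z$-graded $K$-algebra $A$ and $\delta\in\mathbb Z^\Lambda$, let $M_\Lambda(A)(\delta)$ be the ring of $\Lambda\times\Lambda$ matrices over $A$ with only finitely many nonzero entries, graded by $\deg(e_{ij}(a))=\deg(a)+\delta_i-\delta_j$ for homogeneous $a$. Grade $K$ by placing it in degree $0$, and $K[x^t,x^{-t}]\subseteq K[x,x^{-1}]$ by $\deg x=1$. Then: (1) $Soc^{gr}(L)$ is the two-sided ideal of $L$ generated by all line points and all Laurent vertices. (2) Let $X$ be any set of representatives of the classes of line points under the equivalence relation $u\sim v\iff T(u)\cap T(v)\neq\emptyset$, and let $Y$ be the set of all distinct cycles without exits (cycles that differ by a rotation being identified), each $c\in Y$ with a chosen base $w_c$. For $v\in X$ let $\Lambda_v$ be the set of all paths $p$ with $r(p)\in T(v)$ that meet $T(v)$ only at their last vertex, and let $\delta^v_p=|p|-d(v,r(p))$, where $d(v,w)$ is the length of the unique path from $v$ to $w\in T(v)$. (If $v$ is a sink, $\Lambda_v$ is the set of all paths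 that end at $v$, and $\delta^v_p=|p|$.) For $c\in Y$ let $\Upsilon_c$ be the set of all paths $q$ that end at $w_c$ and do not include all the edges of $c$, and let $\varepsilon^c_q=|q|$. Then there is an isomorphism of $\mathbb Z$-graded $K$-algebras $$Soc^{gr}(L)\;\cong_{gr}\;\bigoplus_{v\in X}M_{\Lambda_v}(K)(\delta^v)\;\oplus\;\bigoplus_{c\in Y}M_{\Upsilon_c}\bigl(K[x^{|c|},x^{-|c|}]\bigr)(\varepsilon^c).$$ -/

import Mathlib

noncomputable section

/-! ### Directed graphs -/

/-- A directed graph `(E⁰, E¹, r, s)` with vertex set `V`, edge set `W`, source map `src` and range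
map `tgt`. No finiteness or countability is assumed. -/
structure DirGraph (V : Type*) (W : Type*) where
  /-- the source of an edge -/
  src : W → V
  /-- the range of an edge -/
  tgt : W → V

namespace DirGraph

variable {V W : Type*} (G : DirGraph V W)

/-- `G.IsPath u l v`: the edges in the list `l`, in this order, form a path from `u` to `v`. The
empty list is the path of length `0` at a vertex. -/
def IsPath : V → List W → V → Prop
  | u, [], v => u = v
  | u, e :: l, v => G.src e = u ∧ IsPath (G.tgt e) l v

/-- Paths of the graph (finite, of length `≥ 0`). -/
@[ext]
structure Path where
  /-- the starting vertex -/
  start : V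
  /-- the list of edges of the path -/
  edges : List W
  /-- the final vertex -/
  finish : V
  isPath : G.IsPath start edges finish

/-- The length `|p|` of a path. -/
def Path.length {G : DirGraph V W} (p : G.Path) : ℕ := p.edges.length

/-- The tree `T(v) = {w : v ≥ w}`. -/
def tree (v : V) : Set V := {w | ∃ l, G.IsPath v l w}

/-- `v` is a bifurcation vertex: it emits more than one edge. -/
def IsBifurcation (v : V) : Prop := ∃ e f : W, e ≠ f ∧ G.src e = v ∧ G.src f = v

/-- `v` is a regular vertex: it emits a nonempty finite set of edges. -/
def IsRegular (v : V) : Prop := {e : W | G.src e = v}.Finite ∧ {e : W | G.src e = v}.Nonempty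

/-- The list `c` of edges is a cycle based at `v`: a closed path of positive length whose edges have
pairwise distinct sources. -/
def IsCycleAt (v : V) (c : List W) : Prop :=
  c ≠ [] ∧ G.IsPath v c v ∧ (c.map G.src).Nodup

/-- `f` is an exit for the path with list of edges `l`: there is an edge `e` of `l` with
`s(f) = s(e)` and `f ≠ e`. -/
def IsExit (l : List W) (f : W) : Prop := ∃ e ∈ l, G.src f = G.src e ∧ f ≠ e

/-- `c` is a cycle without exits based at `v`. -/
def IsCycleWithoutExitsAt (v : V) (c : List W) : Prop :=
  G.IsCycleAt v c ∧ ∀ f, ¬ G.IsExit c f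

/-- `v` is a line point: no vertex of `T(v)` is a bifurcation or the base of a cycle. -/
def IsLinePoint (v : V) : Prop :=
  ∀ w ∈ G.tree v, ¬ G.IsBifurcation w ∧ ¬ ∃ c, G.IsCycleAt w c

/-- `v` is a Laurent vertex: `T(v)` is the set of all vertices on a path `μ c`, where `μ` is a path
without bifurcations from `v` to some vertex `u` and `c` is a cycle without exits based at `u`.
(Since `c` ends where it starts, the vertices on `μ c` are the sources of its edges.) -/
def IsLaurentVertex (v : V) : Prop :=
  ∃ (u : V) (μ c : List W), G.IsPath v μ u ∧ (∀ e ∈ μ, ¬ G.IsBifurcation (G.src e)) ∧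
    G.IsCycleWithoutExitsAt u c ∧ G.tree v = {w | ∃ e ∈ μ ++ c, G.src e = w}

/-- `X` is a set of representatives of the classes of line points under the relation
`u ∼ v ↔ T(u) ∩ T(v) ≠ ∅`. -/
def IsLinePointTransversal (X : Set V) : Prop :=
  (∀ v ∈ X, G.IsLinePoint v) ∧
    ∀ u, G.IsLinePoint u → ∃! v, v ∈ X ∧ (G.tree u ∩ G.tree v).Nonempty

/-- The cycles without exits, each one with a choice of its base. -/
def BasedCycleWithoutExits : Type _ :=
  {c : V × List W // G.IsCycleWithoutExitsAt c.1 c.2}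

/-- The base of a based cycle. -/
def BasedCycleWithoutExits.base {G : DirGraph V W} (c : G.BasedCycleWithoutExits) : V := c.1.1

/-- The list of edges of a based cycle. -/
def BasedCycleWithoutExits.edges {G : DirGraph V W} (c : G.BasedCycleWithoutExits) : List W :=
  c.1.2

/-- The length of a based cycle. -/
def BasedCycleWithoutExits.length {G : DirGraph V W} (c : G.BasedCycleWithoutExits) : ℕ :=
  c.edges.length

/-- `Y` contains every cycle without exits exactly once, with some base: two based cycles are the
same cycle if they differ by a rotation. -/
def IsCycleTransversal (Y : Set G.BasedCycleWithoutExits) : Prop :=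
  ∀ d : G.BasedCycleWithoutExits, ∃! c, c ∈ Y ∧ c.edges.IsRotated d.edges

/-- The paths that end on the line `T(v)` issued from the line point `v` and meet it only at their
last vertex. If `v` is a sink, then `T(v) = {v}` and these are all the paths that end at `v`. -/
def LineIndex (v : V) : Type _ :=
  {p : G.Path // p.finish ∈ G.tree v ∧ ∀ e ∈ p.edges, G.src e ∉ G.tree v}

/-- The distance from `v` to a vertex `w` of `T(v)`: the least length of a path from `v` to `w`
(if `v` is a line point, there is only one such path). -/
def dist (v w : V) : ℕ := sInf {n | ∃ l, G.IsPath v l w ∧ l.length = n}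

/-- The shift attached to a path that ends on the line `T(v)`: its length, counted relative to `v`.
If `v` is a sink, this is the length of the path. -/
def lineShift (v : V) (p : G.LineIndex v) : ℤ := (p.1.length : ℤ) - (G.dist v p.1.finish : ℤ)

variable {G} in
/-- The paths that end at the base of `c` and do not include all the edges of `c`. -/
def CycleIndex (c : G.BasedCycleWithoutExits) : Type _ :=
  {p : G.Path // p.finish = c.base ∧ ¬ ∀ e ∈ c.edges, e ∈ p.edges}

variable {G} in
/-- The shift attached to a path that ends at the base of `c`: its length. -/
def cycleShift (c : G.BasedCycleWithoutExits) (q : CycleIndex c) : ℤ := (q.1.length : ℤ)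

end DirGraph

/-! ### The Leavitt path algebra -/

/-- Generators of the Leavitt path algebra: vertices, edges, ghost edges. -/
inductive LeavittGen (V W : Type*)
  | vertex (v : V) : LeavittGen V W
  | edge (e : W) : LeavittGen V W
  | ghost (e : W) : LeavittGen V W

/-- The free associative (not necessarily unital) `K`-algebra on the generators: the semigroup
algebra of the free semigroup. -/
abbrev LeavittFree (K : Type*) [Field K] (V W : Type*) : Type _ :=
  MonoidAlgebra K (FreeSemigroup (LeavittGen V W))

namespace LeavittFree

variable (K : Type*) [Field K] {V W : Type*}

/-- A generator, as an element of the free algebra. -/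
def of (x : LeavittGen V W) : LeavittFree K V W := MonoidAlgebra.single (FreeSemigroup.of x) 1

/-- A vertex in the free algebra. -/
def vertex (v : V) : LeavittFree K V W := of K (.vertex v)

/-- An edge in the free algebra. -/
def edge (e : W) : LeavittFree K V W := of K (.edge e)

/-- A ghost edge in the free algebra. -/
def ghost (e : W) : LeavittFree K V W := of K (.ghost e)

end LeavittFree

namespace DirGraph

variable {V W : Type*} (K : Type*) [Field K] (G : DirGraph V W)

open LeavittFree in
/-- The defining relations of the Leavitt path algebra. -/
inductive LeavittRel : LeavittFree K V W → LeavittFree K V W → Prop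
  | idem (v : V) : LeavittRel (vertex K v * vertex K v) (vertex K v)
  | orth (v w : V) : v ≠ w → LeavittRel (vertex K v * vertex K w) 0
  | src_edge (e : W) : LeavittRel (vertex K (G.src e) * edge K e) (edge K e)
  | edge_tgt (e : W) : LeavittRel (edge K e * vertex K (G.tgt e)) (edge K e)
  | tgt_ghost (e : W) : LeavittRel (vertex K (G.tgt e) * ghost K e) (ghost K e)
  | ghost_src (e : W) : LeavittRel (ghost K e * vertex K (G.src e)) (ghost K e)
  | ck1_same (e : W) : LeavittRel (ghost K e * edge K e) (vertex K (G.tgt e))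
  | ck1_ne (e f : W) : e ≠ f → LeavittRel (ghost K e * edge K f) 0
  | ck2 (v : V) (h : G.IsRegular v) :
      LeavittRel (vertex K v) (∑ e ∈ h.1.toFinset, edge K e * ghost K e)

/-- The congruence of the free `K`-algebra generated by the defining relations (closing the
relations under scalars makes it a congruence of `K`-algebras). -/
def leavittCon : RingCon (LeavittFree K V W) :=
  ringConGen fun x y => ∃ (k : K) (a b : LeavittFree K V W),
    G.LeavittRel K a b ∧ x = k • a ∧ y = k • b

/-- The congruence is compatible with scalar multiplication. -/
theorem leavittCon_smul (k : K) {x y : LeavittFree K V W} (h : G.leavittCon K x y) :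
    G.leavittCon K (k • x) (k • y) := by
  change RingConGen.Rel _ _ _ at h
  induction h with
  | of x y h =>
    obtain ⟨k', a, b, hab, rfl, rfl⟩ := h
    exact RingConGen.Rel.of _ _ ⟨k * k', a, b, hab, by rw [mul_smul], by rw [mul_smul]⟩
  | refl x => exact (G.leavittCon K).refl _
  | symm _ ih => exact (G.leavittCon K).symm ih
  | trans _ _ ih₁ ih₂ => exact (G.leavittCon K).trans ih₁ ih₂
  | add _ _ ih₁ ih₂ => rw [smul_add, smul_add]; exact (G.leavittCon K).add ih₁ ih₂
  | mul _ h₂ ih₁ _ =>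
    rw [← smul_mul_assoc, ← smul_mul_assoc]; exact (G.leavittCon K).mul ih₁ h₂

/-- The Leavitt path algebra `L_K(E)`: the associative (not necessarily unital) `K`-algebra
presented by the vertices, edges and ghost edges and the relations above. -/
def LeavittPathAlgebra : Type _ := (G.leavittCon K).Quotient

namespace LeavittPathAlgebra

instance : NonUnitalRing (G.LeavittPathAlgebra K) :=
  inferInstanceAs (NonUnitalRing (G.leavittCon K).Quotient)

/-- The quotient map from the free algebra, as an additive map. -/
def mkAdd : LeavittFree K V W →+ G.LeavittPathAlgebra K where
  toFun x := (x : (G.leavittCon K).Quotient)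
  map_zero' := rfl
  map_add' _ _ := rfl

theorem mkAdd_surjective : Function.Surjective (mkAdd K G) := Quotient.mk''_surjective

instance : SMul K (G.LeavittPathAlgebra K) :=
  ⟨fun k => Quotient.map' (k • ·) fun _ _ h => G.leavittCon_smul K k h⟩

instance : Module K (G.LeavittPathAlgebra K) :=
  Function.Surjective.module K (mkAdd K G) (mkAdd_surjective K G) fun _ _ => rfl

instance : IsScalarTower K (G.LeavittPathAlgebra K) (G.LeavittPathAlgebra K) where
  smul_assoc k x y := by
    obtain ⟨x, rfl⟩ := mkAdd_surjective K G x
    obtain ⟨y, rfl⟩ := mkAdd_surjective K G y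
    exact congrArg (mkAdd K G) (smul_mul_assoc k x y)

instance : SMulCommClass K (G.LeavittPathAlgebra K) (G.LeavittPathAlgebra K) where
  smul_comm k x y := by
    obtain ⟨x, rfl⟩ := mkAdd_surjective K G x
    obtain ⟨y, rfl⟩ := mkAdd_surjective K G y
    exact congrArg (mkAdd K G) (mul_smul_comm k x y).symm

/-- A vertex, as an element of the Leavitt path algebra. -/
def vertex (v : V) : G.LeavittPathAlgebra K := mkAdd K G (LeavittFree.vertex K v)

/-- An edge, as an element of the Leavitt path algebra. -/
def edge (e : W) : G.LeavittPathAlgebra K := mkAdd K G (LeavittFree.edge K e)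

/-- A ghost edge `e*`, as an element of the Leavitt path algebra. -/
def ghost (e : W) : G.LeavittPathAlgebra K := mkAdd K G (LeavittFree.ghost K e)

/-- The element `u e₁ e₂ ⋯ eₙ`. -/
def pathAux : V → List W → G.LeavittPathAlgebra K
  | u, [] => vertex K G u
  | _, e :: l => edge K G e * pathAux (G.tgt e) l

/-- The element `eₙ* ⋯ e₂* e₁* u`. -/
def ghostPathAux : V → List W → G.LeavittPathAlgebra K
  | u, [] => vertex K G u
  | _, e :: l => ghostPathAux (G.tgt e) l * ghost K G e

variable {G} in
/-- A path `α`, as an element of the Leavitt path algebra. -/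
def path (α : G.Path) : G.LeavittPathAlgebra K := pathAux K G α.start α.edges

variable {G} in
/-- The ghost path `α*`, as an element of the Leavitt path algebra. -/
def ghostPath (α : G.Path) : G.LeavittPathAlgebra K := ghostPathAux K G α.start α.edges

/-- The homogeneous component of degree `n`: the linear combinations of the elements `α β*` with
`|α| - |β| = n`. -/
def grade (n : ℤ) : Submodule K (G.LeavittPathAlgebra K) :=
  Submodule.span K
    {x | ∃ α β : G.Path, (α.length : ℤ) - (β.length : ℤ) = n ∧ x = path K α * ghostPath K β}

/-! ### Graded left ideals and the graded socle -/

variable {K G} in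
/-- `I` is a left ideal. -/
def IsLeftIdeal (I : Submodule K (G.LeavittPathAlgebra K)) : Prop :=
  ∀ a : G.LeavittPathAlgebra K, ∀ x ∈ I, a * x ∈ I

variable {K G} in
/-- `I` is a graded left ideal: a left ideal which is the sum of its intersections with the
homogeneous components. -/
def IsGradedLeftIdeal (I : Submodule K (G.LeavittPathAlgebra K)) : Prop :=
  IsLeftIdeal I ∧ I = ⨆ n : ℤ, I ⊓ grade K G n

variable {K G} in
/-- `S` is a minimal graded left ideal: it is nonzero, and `0` and `S` are the only graded left
ideals inside `S`. -/
def IsMinimalGradedLeftIdeal (S : Submodule K (G.LeavittPathAlgebra K)) : Prop :=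
  IsGradedLeftIdeal S ∧ S ≠ ⊥ ∧ ∀ T, IsGradedLeftIdeal T → T ≤ S → T = ⊥ ∨ T = S

theorem isLeftIdeal_sSup (𝒮 : Set (Submodule K (G.LeavittPathAlgebra K)))
    (h : ∀ S ∈ 𝒮, IsLeftIdeal S) : IsLeftIdeal (sSup 𝒮) := by
  intro a x hx
  have : sSup 𝒮 ≤ (sSup 𝒮).comap (LinearMap.mulLeft K a) :=
    sSup_le fun S hS y hy => (le_sSup hS : S ≤ sSup 𝒮) (h S hS a y hy)
  exact this hx

/-- The graded socle: the sum of all minimal graded left ideals (a left ideal, hence a not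
necessarily unital subalgebra). -/
def gradedSocle : NonUnitalSubalgebra K (G.LeavittPathAlgebra K) :=
  { sSup {S : Submodule K (G.LeavittPathAlgebra K) | IsMinimalGradedLeftIdeal S} with
    mul_mem' := fun {a} {b} _ hb =>
      isLeftIdeal_sSup K G {S | IsMinimalGradedLeftIdeal S} (fun _ hS => hS.1.1) a b hb }

end LeavittPathAlgebra

end DirGraph

/-! ### Matrices with finitely many nonzero entries -/

/-- `M_Λ(A)`: the matrices with entries in `A` indexed by `Λ × Λ`, of which only finitely many are
nonzero. `M i j` is the entry in the row `i` and the column `j`. -/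
def FinMatrix (Λ A : Type*) [Zero A] : Type _ := Λ →₀ Λ →₀ A

namespace FinMatrix

variable {Λ A : Type*}

instance [CommRing A] : AddCommGroup (FinMatrix Λ A) := inferInstanceAs (AddCommGroup (Λ →₀ Λ →₀ A))

instance [CommRing A] {K : Type*} [CommRing K] [Module K A] : Module K (FinMatrix Λ A) :=
  inferInstanceAs (Module K (Λ →₀ Λ →₀ A))

/-- The row `i` of a matrix. -/
def row [Zero A] (M : FinMatrix Λ A) (i : Λ) : Λ →₀ A := DFunLike.coe (F := Λ →₀ Λ →₀ A) M i

instance [Zero A] : CoeFun (FinMatrix Λ A) fun _ => Λ → Λ →₀ A := ⟨row⟩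

/-- The matrix product; row `i` of `M * N` is the linear combination of the rows of `N` with
coefficients in row `i` of `M` (see `FinMatrix.mul_apply`). -/
instance [CommRing A] : Mul (FinMatrix Λ A) where
  mul M N := Finsupp.mapRange (Finsupp.linearCombination A N.row) (map_zero _) M

theorem mul_row [CommRing A] (M N : FinMatrix Λ A) (i : Λ) :
    (M * N) i = Finsupp.linearCombination A N.row (M i) := rfl

/-- The entries of the product are given by the usual formula. -/
theorem mul_apply [CommRing A] (M N : FinMatrix Λ A) (i j : Λ) :
    (M * N) i j = (M i).sum fun k a => a * N k j := by
  rw [mul_row, Finsupp.linearCombination_apply, Finsupp.sum_apply]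
  rfl

theorem ext_rows [CommRing A] {M N : FinMatrix Λ A} (h : ∀ i, M i = N i) : M = N :=
  Finsupp.ext h

theorem add_row [CommRing A] (M N : FinMatrix Λ A) (i : Λ) : (M + N) i = M i + N i := rfl

instance [CommRing A] : NonUnitalRing (FinMatrix Λ A) :=
  { (inferInstance : AddCommGroup (FinMatrix Λ A)), (inferInstance : Mul (FinMatrix Λ A)) with
    left_distrib := fun M N P => ext_rows fun i => by
      simp only [mul_row, add_row, Finsupp.linearCombination_apply, smul_add, Finsupp.sum_add]
    right_distrib := fun M N P => ext_rows fun i => by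
      simp only [mul_row, add_row, map_add]
    zero_mul := fun M => ext_rows fun i => map_zero (Finsupp.linearCombination A M.row)
    mul_zero := fun M => ext_rows fun i => by
      rw [mul_row, Finsupp.linearCombination_apply]
      exact Finset.sum_eq_zero fun k _ => smul_zero _
    mul_assoc := fun M N P => ext_rows fun i => by
      have h : Finsupp.linearCombination A P.row ∘ₗ Finsupp.linearCombination A N.row =
          Finsupp.linearCombination A (N * P).row := by
        ext k
        simp [mul_row]
      exact LinearMap.congr_fun h (M i) }

/-- The homogeneous component of degree `n` of `M_Λ(A)(δ)`, where `A` is graded by `𝒜`: the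
matrices whose `(i, j)`-entry has degree `n + δ j - δ i`; that is, the matrix with the single entry
`a` in the position `(i, j)` has degree `deg a + δ i - δ j`. -/
def grade {K : Type*} [CommRing K] [CommRing A] [Module K A] (𝒜 : ℤ → Submodule K A) (δ : Λ → ℤ)
    (n : ℤ) : Set (FinMatrix Λ A) :=
  {M | ∀ i j, M i j ∈ 𝒜 (n + δ j - δ i)}

end FinMatrix

/-! ### The graded rings `K` and `K[xᵗ, x⁻ᵗ]` -/

/-- The field `K` as a graded ring concentrated in degree `0`. -/
def fieldGrade (K : Type*) [Field K] (n : ℤ) : Submodule K K := if n = 0 then ⊤ else ⊥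

open LaurentPolynomial in
/-- The subalgebra `K[xᵗ, x⁻ᵗ]` of `K[x, x⁻¹]`. -/
def LaurentPow (K : Type*) [Field K] (t : ℕ) : Subalgebra K K[T;T⁻¹] :=
  Algebra.adjoin K {T (t : ℤ), T (-(t : ℤ))}

open LaurentPolynomial in
/-- The grading of `K[xᵗ, x⁻ᵗ]` induced by that of `K[x, x⁻¹]`, in which `x` has degree `1`: the
elements of degree `n` are the scalar multiples of `xⁿ` that lie in `K[xᵗ, x⁻ᵗ]`. -/
def laurentPowGrade (K : Type*) [Field K] (t : ℕ) (n : ℤ) : Submodule K (LaurentPow K t) :=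
  (Submodule.span K {(T n : K[T;T⁻¹])}).comap (LaurentPow K t).val.toLinearMap

/-! ### Direct sums of rings -/

/-- The direct sum `⨁ i, R i` of a family of (not necessarily unital) `K`-algebras: the families
with finitely many nonzero components, with componentwise operations. -/
def algDirectSum (K : Type*) [CommRing K] {ι : Type*} (R : ι → Type*) [∀ i, NonUnitalRing (R i)]
    [∀ i, Module K (R i)] : NonUnitalSubalgebra K (∀ i, R i) where
  carrier := {f | {i | f i ≠ 0}.Finite}
  zero_mem' := by simp
  add_mem' {f g} hf hg := (hf.union hg).subset fun i hi => by
    by_contra h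
    simp only [Set.mem_union, Set.mem_ofPred_eq, not_or, not_not] at h
    exact hi (by simp [h.1, h.2])
  mul_mem' {f g} hf _ := hf.subset fun i hi h => hi (by simp [h])
  smul_mem' k f hf := hf.subset fun i hi h => hi (by simp [h])

namespace DirGraph

variable {V W : Type*} (K : Type*) [Field K] (G : DirGraph V W)

/-- The ring `⨁_{v ∈ X} M_{Λ_v}(K) ⊕ ⨁_{c ∈ Y} M_{Υ_c}(K[x^|c|, x^-|c|])`. -/
abbrev SocleModel (X : Set V) (Y : Set G.BasedCycleWithoutExits) : Type _ :=
  algDirectSum K (fun v : X => FinMatrix (G.LineIndex v.1) K) ×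
    algDirectSum K (fun c : Y => FinMatrix (CycleIndex c.1) (LaurentPow K c.1.length))

/-- The homogeneous component of degree `n` of `SocleModel`, all the matrix rings carrying the
gradings shifted by `lineShift` and `cycleShift`. -/
def socleModelGrade (X : Set V) (Y : Set G.BasedCycleWithoutExits) (n : ℤ) :
    Set (G.SocleModel K X Y) :=
  {f | (∀ v : X, f.1.1 v ∈ FinMatrix.grade (fieldGrade K) (G.lineShift v.1) n) ∧
    ∀ c : Y, f.2.1 c ∈ FinMatrix.grade (laurentPowGrade K c.1.length) (cycleShift c.1) n}

end DirGraph

end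

/-! # The graded socle of a Leavitt path algebra -/

namespace DirGraph

variable {V W : Type*} {G : DirGraph V W}

/-! ### Paths in a directed graph -/

/-! Call a vertex straight if its tree contains no bifurcation. The straight vertices are exactly
the line points and the Laurent vertices (`isStraight_iff`). What singles them out algebraically is
that a path `α` starting at such a vertex satisfies `α α* = s(α)` as well as `α* α = r(α)`, so it
can be cancelled on both sides.

The graded socle is found by reduction (`exists_reduction`): every nonzero homogeneous `a` has paths
`α`, `β` with `α* a β = k v`, where `k ≠ 0` and `v` is a vertex. If `r(β)` is straight, then any
nonzero homogeneous `c β*` can be carried back to a multiple of `β*` by left multiplication, so `L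
β*` is minimal. Conversely, a minimal graded left ideal has a homogeneous generator `s = w s` with
`s μ = k w` for some path `μ`. If `w` reached a bifurcation, there would be two paths `p`, `q` from
`w` with `p* q = 0`. Minimality gives `s = c p* s`, hence `w = c p*` and `q = c p* q = 0`, which is
absurd. So the socle is spanned by the `α β*` whose common range is straight (`straightIdeal`), and
this span is the two-sided ideal generated by the straight vertices.

For the matrix description, each such `α β*` is prolonged to `α μ μ* β*` until it ends on a chosen
line or at the base of a chosen cycle. Cutting paths where they first meet the line, or stripping
off powers of the cycle, gives matrix units with coefficients in `K v` for a line and in the integer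
powers of `c` for a cycle `c`, which is invertible in its corner because it has no exit. Units
attached to different lines or cycles are orthogonal because the trees are disjoint. All entries of
a matrix are recovered from its image as `y p * ψ f * x q`, which gives both injectivity and the
exact matching of degrees (`exists_socleModel_embedding`).

A presentation alone does not show that anything is nonzero. This comes from a representation by
operators that also records degrees; it yields, for each vertex, a linear form equal to `1` there
and zero on all components of nonzero degree (`exists_linear_form`). That form takes the place of
linear independence of paths and of directness of the grading. -/

theorem isPath_append {u w : V} {l l' : List W} :
    G.IsPath u (l ++ l') w ↔ ∃ v, G.IsPath u l v ∧ G.IsPath v l' w := by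
  induction l generalizing u with
  | nil => simp [IsPath]
  | cons e l ih => simp [IsPath, ih, and_assoc]

theorem IsPath.append {u v w : V} {l l' : List W} (h : G.IsPath u l v) (h' : G.IsPath v l' w) :
    G.IsPath u (l ++ l') w :=
  isPath_append.2 ⟨v, h, h'⟩

theorem IsPath.finish_unique {u v w : V} {l : List W} (h : G.IsPath u l v)
    (h' : G.IsPath u l w) : v = w := by
  induction l generalizing u with
  | nil => exact Eq.trans (Eq.symm h) h'
  | cons e l ih => exact ih h.2 h'.2

theorem isPath_singleton (e : W) : G.IsPath (G.src e) [e] (G.tgt e) := ⟨rfl, rfl⟩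

theorem mem_tree_self (v : V) : v ∈ G.tree v := ⟨[], rfl⟩

theorem tree_subset {u v : V} (h : v ∈ G.tree u) : G.tree v ⊆ G.tree u := by
  obtain ⟨l, hl⟩ := h
  rintro w ⟨l', hl'⟩
  exact ⟨l ++ l', hl.append hl'⟩

theorem IsPath.split_of_mem {u v : V} {l : List W} (h : G.IsPath u l v) {e : W} (he : e ∈ l) :
    ∃ l₁ l₂, l = l₁ ++ e :: l₂ ∧ G.IsPath u l₁ (G.src e) ∧ G.IsPath (G.tgt e) l₂ v := by
  obtain ⟨l₁, l₂, rfl⟩ := List.append_of_mem he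
  obtain ⟨w, h₁, rfl, h₂⟩ := isPath_append.1 h
  exact ⟨l₁, l₂, rfl, h₁, h₂⟩

theorem IsPath.src_mem_tree {u v : V} {l : List W} (h : G.IsPath u l v) {e : W} (he : e ∈ l) :
    G.src e ∈ G.tree u := by
  obtain ⟨l₁, -, -, h₁, -⟩ := h.split_of_mem he
  exact ⟨l₁, h₁⟩

theorem IsPath.exists_src_eq {u v : V} {l : List W} (h : G.IsPath u l v) (hl : l ≠ []) :
    ∃ e ∈ l, G.src e = u := by
  cases l with
  | nil => exact absurd rfl hl
  | cons e l => exact ⟨e, List.mem_cons_self, h.1⟩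

/-- A path that ends in a set of vertices factors at the first vertex it has in this set. -/
theorem IsPath.exists_first_entry (S : Set V) {u v : V} {l : List W} (h : G.IsPath u l v)
    (hv : v ∈ S) :
    ∃ l₁ l₂ w, l = l₁ ++ l₂ ∧ G.IsPath u l₁ w ∧ G.IsPath w l₂ v ∧ w ∈ S ∧
      ∀ e ∈ l₁, G.src e ∉ S := by
  induction l generalizing u with
  | nil =>
    obtain rfl : u = v := h
    exact ⟨[], [], u, rfl, rfl, rfl, hv, by simp⟩
  | cons e l ih =>
    by_cases hu : u ∈ S
    · exact ⟨[], e :: l, u, rfl, rfl, h, hu, by simp⟩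
    · obtain ⟨l₁, l₂, w, rfl, h₁, h₂, hw, hl₁⟩ := ih h.2
      refine ⟨e :: l₁, l₂, w, rfl, ⟨h.1, h₁⟩, h₂, hw, ?_⟩
      simpa [h.1, hu] using hl₁

/-- A vertex is straight if its tree contains no bifurcation. -/
def IsStraight (G : DirGraph V W) (v : V) : Prop := ∀ w ∈ G.tree v, ¬ G.IsBifurcation w

theorem IsStraight.of_mem_tree {u v : V} (h : G.IsStraight u) (hv : v ∈ G.tree u) :
    G.IsStraight v := fun w hw => h w (tree_subset hv hw)

theorem eq_of_not_isBifurcation {v : V} (h : ¬ G.IsBifurcation v) {e f : W} (he : G.src e = v)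
    (hf : G.src f = v) : e = f := by
  by_contra hne
  exact h ⟨e, f, hne, he, hf⟩

/-- Of two paths starting at a straight vertex, one is a prefix of the other. -/
theorem IsStraight.prefix_or_prefix {u v w : V} (hu : G.IsStraight u) {l l' : List W}
    (h : G.IsPath u l v) (h' : G.IsPath u l' w) :
    (∃ σ, l' = l ++ σ ∧ G.IsPath v σ w) ∨ ∃ σ, l = l' ++ σ ∧ G.IsPath w σ v := by
  induction l generalizing u l' with
  | nil =>
    obtain rfl : u = v := h
    exact Or.inl ⟨l', rfl, h'⟩
  | cons e l ih =>
    cases l' with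
    | nil =>
      obtain rfl : u = w := h'
      exact Or.inr ⟨e :: l, rfl, h⟩
    | cons f l' =>
      obtain rfl := eq_of_not_isBifurcation (hu u (mem_tree_self u)) h.1 h'.1
      rcases ih (hu.of_mem_tree ⟨[e], h.1, rfl⟩) h.2 h'.2 with ⟨σ, rfl, hσ⟩ | ⟨σ, rfl, hσ⟩
      · exact Or.inl ⟨σ, rfl, hσ⟩
      · exact Or.inr ⟨σ, rfl, hσ⟩

theorem exists_eq_of_not_nodup_map {α β : Type*} (f : α → β) {l : List α}
    (h : ¬ (l.map f).Nodup) :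
    ∃ l₁ a l₂ b l₃, l = l₁ ++ a :: (l₂ ++ b :: l₃) ∧ f a = f b := by
  induction l with
  | nil => simp at h
  | cons x l ih =>
    by_cases hx : f x ∈ l.map f
    · obtain ⟨b, hb, hbx⟩ := List.mem_map.1 hx
      obtain ⟨l₂, l₃, rfl⟩ := List.append_of_mem hb
      exact ⟨[], x, l₂, b, l₃, rfl, hbx.symm⟩
    · rw [List.map_cons, List.nodup_cons, not_and] at h
      obtain ⟨l₁, a, l₂, b, l₃, rfl, hab⟩ := ih (h hx)
      exact ⟨x :: l₁, a, l₂, b, l₃, rfl, hab⟩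

/-- A nontrivial closed path visits the base of a cycle. -/
theorem IsPath.exists_isCycleAt {v : V} {l : List W} (h : G.IsPath v l v) (hl : l ≠ []) :
    ∃ w ∈ G.tree v, ∃ c, G.IsCycleAt w c := by
  induction hn : l.length using Nat.strong_induction_on generalizing v l with
  | _ n ih =>
    by_cases hnd : (l.map G.src).Nodup
    · exact ⟨v, mem_tree_self v, l, hl, h, hnd⟩
    · obtain ⟨l₁, a, l₂, b, l₃, rfl, hab⟩ := exists_eq_of_not_nodup_map _ hnd
      obtain ⟨w, h₁, rfl, h₂⟩ := isPath_append.1 h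
      obtain ⟨x, h₃, h₄, -⟩ := isPath_append.1 h₂
      -- As `a` and `b` have the same source, `a :: l₂` is itself a closed path; it is shorter
      -- because it omits `b`.
      obtain ⟨w, hw, hc⟩ := ih _ (by simp at hn ⊢; omega)
        (show G.IsPath (G.src a) (a :: l₂) (G.src a) from ⟨rfl, by rwa [hab, h₄]⟩) (by simp) rfl
      exact ⟨w, tree_subset ⟨l₁, h₁⟩ hw, hc⟩

theorem IsLinePoint.isStraight {v : V} (h : G.IsLinePoint v) : G.IsStraight v :=
  fun w hw => (h w hw).1

/-- There is at most one path from a line point to a given vertex. -/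
theorem IsLinePoint.path_unique {v w : V} (h : G.IsLinePoint v) {l l' : List W}
    (hl : G.IsPath v l w) (hl' : G.IsPath v l' w) : l = l' := by
  have key : ∀ σ, G.IsPath w σ w → σ = [] := by
    intro σ hσ
    by_contra hne
    obtain ⟨x, hx, hc⟩ := hσ.exists_isCycleAt hne
    exact (h x (tree_subset ⟨l, hl⟩ hx)).2 hc
  rcases h.isStraight.prefix_or_prefix hl hl' with ⟨σ, rfl, hσ⟩ | ⟨σ, rfl, hσ⟩ <;>
    simp [key σ hσ]

theorem IsLinePoint.dist_eq {v w : V} (h : G.IsLinePoint v) {l : List W} (hl : G.IsPath v l w) :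
    G.dist v w = l.length := by
  have : {n | ∃ l, G.IsPath v l w ∧ l.length = n} = {l.length} := by
    ext n
    constructor
    · rintro ⟨l', hl', rfl⟩
      rw [h.path_unique hl hl', Set.mem_singleton_iff]
    · rintro rfl
      exact ⟨l, hl, rfl⟩
  rw [dist, this, csInf_singleton]

/-! ### Cycles without exits -/

/-- Two nonempty closed pieces would each begin with an edge of source `v`, against the distinctness
of the sources on a cycle. -/
theorem IsCycleAt.eq_nil_of_append {v : V} {l σ : List W} (h : G.IsCycleAt v (l ++ σ))
    (hl : l ≠ []) (hp : G.IsPath v l v) : σ = [] := by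
  by_contra hσ
  obtain ⟨w, h₁, h₂⟩ := isPath_append.1 h.2.1
  obtain rfl := h₁.finish_unique hp
  obtain ⟨e, he, hev⟩ := hp.exists_src_eq hl
  obtain ⟨f, hf, hfv⟩ := h₂.exists_src_eq hσ
  have hnd := h.2.2
  rw [List.map_append, List.nodup_append'] at hnd
  exact hnd.2.2 (List.mem_map_of_mem he) (by rw [hev, ← hfv]; exact List.mem_map_of_mem hf)

theorem IsStraight.isCycleAt_unique {v : V} (hv : G.IsStraight v) {c d : List W}
    (hc : G.IsCycleAt v c) (hd : G.IsCycleAt v d) : c = d := by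
  rcases hv.prefix_or_prefix hc.2.1 hd.2.1 with ⟨σ, rfl, -⟩ | ⟨σ, rfl, -⟩
  · simp [hd.eq_nil_of_append hc.1 hc.2.1]
  · simp [hc.eq_nil_of_append hd.1 hd.2.1]

theorem IsPath.flatten_replicate {v : V} {c : List W} (h : G.IsPath v c v) (k : ℕ) :
    G.IsPath v (List.replicate k c).flatten v := by
  induction k with
  | zero => rfl
  | succ k ih => rw [List.replicate_succ, List.flatten_cons]; exact h.append ih

/-- The closed paths at the base of a straight cycle are the powers of the cycle. -/
theorem IsStraight.eq_flatten_replicate {v : V} (hv : G.IsStraight v) {c l : List W}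
    (hc : G.IsCycleAt v c) (hl : G.IsPath v l v) : ∃ k, l = (List.replicate k c).flatten := by
  induction hn : l.length using Nat.strong_induction_on generalizing l with
  | _ n ih =>
    by_cases hnil : l = []
    · exact ⟨0, hnil⟩
    rcases hv.prefix_or_prefix hc.2.1 hl with ⟨σ, rfl, hσ⟩ | ⟨σ, rfl, -⟩
    · have : 0 < c.length := List.length_pos_of_ne_nil hc.1
      obtain ⟨k, rfl⟩ := ih σ.length (by simp at hn; omega) hσ rfl
      exact ⟨k + 1, by rw [List.replicate_succ, List.flatten_cons]⟩
    · obtain rfl := hc.eq_nil_of_append hnil hl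
      exact ⟨1, by simp⟩

theorem IsCycleWithoutExitsAt.eq_of_src_eq {v : V} {c : List W} (h : G.IsCycleWithoutExitsAt v c)
    {e f : W} (he : e ∈ c) (hf : G.src f = G.src e) : f = e := by
  by_contra hne
  exact h.2 f ⟨e, he, hf, hne⟩

/-- The vertices that can be reached from a cycle without exits lie on the cycle. -/
theorem IsCycleWithoutExitsAt.exists_split {v w : V} {c : List W}
    (h : G.IsCycleWithoutExitsAt v c) (hw : w ∈ G.tree v) :
    ∃ c₁ c₂, c = c₁ ++ c₂ ∧ c₁ ≠ [] ∧ G.IsPath v c₁ w ∧ G.IsPath w c₂ v := by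
  obtain ⟨l, hl⟩ := hw
  -- Induction on the path, following the position `u` on the cycle. Requiring `c₁ ≠ []` places the
  -- base at the end of `c`, so `c₂` is always a proper suffix.
  suffices H : ∀ u, (∃ c₁ c₂, c = c₁ ++ c₂ ∧ c₁ ≠ [] ∧ G.IsPath v c₁ u ∧ G.IsPath u c₂ v) →
      G.IsPath u l w → ∃ c₁ c₂, c = c₁ ++ c₂ ∧ c₁ ≠ [] ∧ G.IsPath v c₁ w ∧ G.IsPath w c₂ v from
    H v ⟨c, [], by simp, h.1.1, h.1.2.1, rfl⟩ hl
  clear hl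
  induction l with
  | nil => rintro u hu rfl; exact hu
  | cons e l ih =>
    rintro u ⟨c₁, c₂, hc, hne, h₁, h₂⟩ ⟨rfl, hl⟩
    refine ih _ ?_ hl
    cases c₂ with
    | nil =>
      -- A full turn is complete; without exits, the next edge can only be the first edge of `c`.
      have hv : G.src e = v := h₂
      obtain ⟨f, c', rfl⟩ := List.exists_cons_of_ne_nil h.1.1
      obtain rfl := h.eq_of_src_eq (f := e) List.mem_cons_self (hv.trans h.1.2.1.1.symm)
      exact ⟨[e], c', rfl, by simp, ⟨hv, rfl⟩, h.1.2.1.2⟩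
    | cons f c' =>
      obtain rfl := h.eq_of_src_eq (f := e) (by simp [hc] : f ∈ c) h₂.1.symm
      exact ⟨c₁ ++ [e], c', by simp [hc], by simp, h₁.append (isPath_singleton e), h₂.2⟩

theorem IsCycleWithoutExitsAt.exists_mem_src_eq {v w : V} {c : List W}
    (h : G.IsCycleWithoutExitsAt v c) (hw : w ∈ G.tree v) : ∃ e ∈ c, G.src e = w := by
  obtain ⟨c₁, c₂, rfl, hne, h₁, h₂⟩ := h.exists_split hw
  cases c₂ with
  | nil =>
    obtain rfl : w = v := h₂
    exact h.1.2.1.exists_src_eq h.1.1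
  | cons f c' => exact ⟨f, by simp, h₂.1⟩

theorem IsCycleWithoutExitsAt.isStraight {v : V} {c : List W}
    (h : G.IsCycleWithoutExitsAt v c) : G.IsStraight v := by
  rintro w hw ⟨e, f, hne, rfl, hf⟩
  obtain ⟨g, hg, hge⟩ := h.exists_mem_src_eq hw
  exact hne ((h.eq_of_src_eq hg hge.symm).trans (h.eq_of_src_eq hg (hf.trans hge.symm)).symm)

theorem IsStraight.isCycleWithoutExitsAt {v : V} {c : List W} (hv : G.IsStraight v)
    (hc : G.IsCycleAt v c) : G.IsCycleWithoutExitsAt v c := by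
  refine ⟨hc, ?_⟩
  rintro f ⟨e, he, hfe, hne⟩
  exact hne (eq_of_not_isBifurcation (hv _ (hc.2.1.src_mem_tree he)) hfe rfl)

/-- Cycles without exits that reach a common vertex differ by a rotation. -/
theorem IsCycleWithoutExitsAt.isRotated {u v w : V} {c d : List W}
    (hc : G.IsCycleWithoutExitsAt u c) (hd : G.IsCycleWithoutExitsAt v d) (hu : w ∈ G.tree u)
    (hv : w ∈ G.tree v) : c.IsRotated d := by
  -- Both cycles are rotated so as to be based at `w`; a straight vertex is the base of only one
  -- cycle.
  have key : ∀ {v : V} {c : List W}, G.IsCycleWithoutExitsAt v c → w ∈ G.tree v →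
      ∃ d, G.IsCycleAt w d ∧ c.IsRotated d := by
    intro v c hc hw
    obtain ⟨c₁, c₂, rfl, hne, h₁, h₂⟩ := hc.exists_split hw
    refine ⟨c₂ ++ c₁, ⟨by simp [hne], h₂.append h₁, ?_⟩, List.isRotated_append⟩
    exact ((List.perm_append_comm.map G.src).nodup_iff).1 hc.1.2.2
  obtain ⟨c', hc', hcc'⟩ := key hc hu
  obtain ⟨d', hd', hdd'⟩ := key hd hv
  rw [(hc.isStraight.of_mem_tree hu).isCycleAt_unique hc' hd'] at hcc'
  exact hcc'.trans hdd'.symm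

/-- A vertex reached from a cycle without exits lies on a closed path, and no closed path of
positive length can be reached from a line point. -/
theorem IsLinePoint.disjoint_tree_cycle {u v : V} {c : List W} (hu : G.IsLinePoint u)
    (hc : G.IsCycleWithoutExitsAt v c) : ¬ (G.tree u ∩ G.tree v).Nonempty := by
  rintro ⟨w, hw, hw'⟩
  obtain ⟨c₁, c₂, rfl, hne, h₁, h₂⟩ := hc.exists_split hw'
  obtain ⟨x, hx, hcx⟩ := (h₂.append h₁).exists_isCycleAt (by simp [hne])
  exact (hu x (tree_subset hw hx)).2 hcx

/-- A path that ends at the base of a cycle without exits is a path that does not include all the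
edges of the cycle, followed by a power of the cycle. -/
theorem IsCycleWithoutExitsAt.exists_eq_append {u v : V} {c l : List W}
    (h : G.IsCycleWithoutExitsAt v c) (hl : G.IsPath u l v) :
    ∃ q k, l = q ++ (List.replicate k c).flatten ∧ G.IsPath u q v ∧ ¬ ∀ e ∈ c, e ∈ q := by
  obtain ⟨p, σ, w, rfl, hp, hσ, hw, hpw⟩ := hl.exists_first_entry (G.tree v) (mem_tree_self v)
  obtain ⟨c₁, c₂, hc, hne, h₁, h₂⟩ := h.exists_split hw
  -- `c₂` leads from the entry vertex `w` to the base in less than a full turn. The first edge of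
  -- `c₁` is missing from `p ++ c₂`: its source `v` is not met by `p`, and it differs from the
  -- sources in `c₂`.
  have hnot : ¬ ∀ e ∈ c, e ∈ p ++ c₂ := by
    intro hall
    obtain ⟨e, he, hev⟩ := h₁.exists_src_eq hne
    have hnd := h.1.2.2
    rw [hc, List.map_append, List.nodup_append'] at hnd
    rcases List.mem_append.1 (hall e (by simp [hc, he])) with h' | h'
    · exact hpw e h' (by rw [hev]; exact mem_tree_self v)
    · exact hnd.2.2 (List.mem_map_of_mem he) (List.mem_map_of_mem h')
  -- Either `σ` traverses `c₂` and then winds around the cycle, or `c₂ = σ ++ ρ` with `ρ` a power of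
  -- `c`. In the second case `ρ` is trivial, since `c₂` is shorter than `c`.
  rcases (h.isStraight.of_mem_tree hw).prefix_or_prefix h₂ hσ with ⟨ρ, rfl, hρ⟩ | ⟨ρ, rfl, hρ⟩
  · obtain ⟨k, rfl⟩ := h.isStraight.eq_flatten_replicate h.1 hρ
    exact ⟨p ++ c₂, k, by simp, hp.append h₂, hnot⟩
  · obtain ⟨k, rfl⟩ := h.isStraight.eq_flatten_replicate h.1 hρ
    cases k with
    | zero => exact ⟨p ++ σ, 0, by simp, hp.append hσ, by simpa using hnot⟩
    | succ k =>
      have : 0 < c₁.length := List.length_pos_of_ne_nil hne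
      have := congrArg List.length hc
      simp [List.replicate_succ] at this
      omega

/-- Without bifurcations there is at most one way to continue from each vertex of `T(v)`. Either
this route never meets the base of a cycle, or it runs into a cycle, which has no exit because its
vertices emit one edge each. -/
theorem isStraight_iff {v : V} : G.IsStraight v ↔ G.IsLinePoint v ∨ G.IsLaurentVertex v := by
  constructor
  · intro hv
    by_cases hline : ∃ w ∈ G.tree v, ∃ c, G.IsCycleAt w c
    · obtain ⟨w, hw, c, hc⟩ := hline
      have hc' := (hv.of_mem_tree hw).isCycleWithoutExitsAt hc
      obtain ⟨μ, hμ⟩ := hw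
      refine Or.inr ⟨w, μ, c, hμ, fun e he => hv _ (hμ.src_mem_tree he), hc', ?_⟩
      ext x
      constructor
      · rintro ⟨l, hl⟩
        rcases hv.prefix_or_prefix hμ hl with ⟨σ, rfl, hσ⟩ | ⟨σ, rfl, hσ⟩
        · obtain ⟨e, he, hex⟩ := hc'.exists_mem_src_eq ⟨σ, hσ⟩
          exact ⟨e, by simp [he], hex⟩
        · by_cases hnil : σ = []
          · subst hnil
            obtain rfl : x = w := hσ
            obtain ⟨e, he, hex⟩ := hc.2.1.exists_src_eq hc.1
            exact ⟨e, by simp [he], hex⟩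
          · obtain ⟨e, he, hex⟩ := hσ.exists_src_eq hnil
            exact ⟨e, by simp [he], hex⟩
      · rintro ⟨e, he, rfl⟩
        exact (hμ.append hc.2.1).src_mem_tree he
    · push Not at hline
      exact Or.inl fun w hw => ⟨hv w hw, fun ⟨c, hc⟩ => hline w hw c hc⟩
  · rintro (h | ⟨u, μ, c, hμ, hμb, hc, htree⟩)
    · exact h.isStraight
    · intro w hw
      rw [htree] at hw
      obtain ⟨e, he, rfl⟩ := hw
      rcases List.mem_append.1 he with he | he
      · exact hμb e he
      · exact hc.isStraight _ (hc.1.2.1.src_mem_tree he)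

/-- A straight vertex is a line point or reaches a cycle without exits. -/
theorem IsStraight.isLinePoint_or {v : V} (hv : G.IsStraight v) :
    G.IsLinePoint v ∨ ∃ d : G.BasedCycleWithoutExits, d.base ∈ G.tree v := by
  refine (isStraight_iff.1 hv).imp_right ?_
  rintro ⟨u, μ, c, hμ, -, hc, -⟩
  exact ⟨⟨(u, c), hc⟩, μ, hμ⟩

theorem BasedCycleWithoutExits.base_mem_tree {c d : G.BasedCycleWithoutExits}
    (h : c.edges.IsRotated d.edges) : c.base ∈ G.tree d.base := by
  obtain ⟨e, he, hev⟩ := c.2.1.2.1.exists_src_eq c.2.1.1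
  have := d.2.1.2.1.src_mem_tree (h.mem_iff.1 he)
  rwa [hev] at this

end DirGraph

noncomputable section
namespace DirGraph.LeavittPathAlgebra

variable {V W : Type*} (K : Type*) [Field K] (G : DirGraph V W)

/-! ### Relations between the generators -/

theorem mkAdd_mul (x y : LeavittFree K V W) : mkAdd K G (x * y) = mkAdd K G x * mkAdd K G y := rfl

theorem mkAdd_smul (k : K) (x : LeavittFree K V W) : mkAdd K G (k • x) = k • mkAdd K G x := rfl

variable {K G} in
theorem mkAdd_eq {a b : LeavittFree K V W} (h : G.LeavittRel K a b) :
    mkAdd K G a = mkAdd K G b :=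
  (RingCon.eq (G.leavittCon K)).2
    (RingConGen.Rel.of _ _ ⟨1, a, b, h, (one_smul K a).symm, (one_smul K b).symm⟩)

theorem vertex_mul_self (v : V) : vertex K G v * vertex K G v = vertex K G v :=
  mkAdd_eq (.idem v)

theorem vertex_mul_of_ne {v w : V} (h : v ≠ w) : vertex K G v * vertex K G w = 0 :=
  mkAdd_eq (.orth v w h)

theorem src_mul_edge (e : W) : vertex K G (G.src e) * edge K G e = edge K G e :=
  mkAdd_eq (.src_edge e)

theorem edge_mul_tgt (e : W) : edge K G e * vertex K G (G.tgt e) = edge K G e :=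
  mkAdd_eq (.edge_tgt e)

theorem tgt_mul_ghost (e : W) : vertex K G (G.tgt e) * ghost K G e = ghost K G e :=
  mkAdd_eq (.tgt_ghost e)

theorem ghost_mul_src (e : W) : ghost K G e * vertex K G (G.src e) = ghost K G e :=
  mkAdd_eq (.ghost_src e)

theorem ghost_mul_edge_self (e : W) : ghost K G e * edge K G e = vertex K G (G.tgt e) :=
  mkAdd_eq (.ck1_same e)

theorem ghost_mul_edge_of_ne {e f : W} (h : e ≠ f) : ghost K G e * edge K G f = 0 :=
  mkAdd_eq (.ck1_ne e f h)

theorem vertex_eq_sum {v : V} (h : G.IsRegular v) :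
    vertex K G v = ∑ e ∈ h.1.toFinset, edge K G e * ghost K G e :=
  (mkAdd_eq (.ck2 v h)).trans (map_sum (mkAdd K G) _ _)

variable {G} in
-- At a vertex that emits only `e`, the sum in `ck2` has a single term.
theorem edge_mul_ghost_self {e : W} (h : ¬ G.IsBifurcation (G.src e)) :
    edge K G e * ghost K G e = vertex K G (G.src e) := by
  have hs : {f | G.src f = G.src e} = {e} := by
    ext f
    exact ⟨fun hf => eq_of_not_isBifurcation h hf rfl,
      fun hf => by rw [Set.mem_singleton_iff.1 hf]; rfl⟩
  have hr : G.IsRegular (G.src e) := by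
    rw [IsRegular, hs]
    exact ⟨Set.finite_singleton e, Set.singleton_nonempty e⟩
  have : hr.1.toFinset = {e} := by
    ext f
    rw [Set.Finite.mem_toFinset, hs, Set.mem_singleton_iff, Finset.mem_singleton]
  rw [vertex_eq_sum K G hr, this, Finset.sum_singleton]

/-! ### Paths and ghost paths -/

variable {G}

theorem vertex_mul_pathAux {u v : V} {l : List W} (h : G.IsPath u l v) :
    vertex K G u * pathAux K G u l = pathAux K G u l := by
  cases l with
  | nil => exact vertex_mul_self K G u
  | cons e l => rw [pathAux, ← h.1, ← mul_assoc, src_mul_edge]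

theorem pathAux_mul_vertex {u v : V} {l : List W} (h : G.IsPath u l v) :
    pathAux K G u l * vertex K G v = pathAux K G u l := by
  induction l generalizing u with
  | nil => obtain rfl : u = v := h; exact vertex_mul_self K G u
  | cons e l ih => rw [pathAux, mul_assoc, ih h.2]

theorem vertex_mul_ghostPathAux {u v : V} {l : List W} (h : G.IsPath u l v) :
    vertex K G v * ghostPathAux K G u l = ghostPathAux K G u l := by
  induction l generalizing u with
  | nil => obtain rfl : u = v := h; exact vertex_mul_self K G u
  | cons e l ih => rw [ghostPathAux, ← mul_assoc, ih h.2]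

theorem ghostPathAux_mul_vertex {u v : V} {l : List W} (h : G.IsPath u l v) :
    ghostPathAux K G u l * vertex K G u = ghostPathAux K G u l := by
  cases l with
  | nil => exact vertex_mul_self K G u
  | cons e l => rw [ghostPathAux, ← h.1, mul_assoc, ghost_mul_src]

theorem vertex_mul_pathAux_of_ne {u v w : V} {l : List W} (h : G.IsPath u l v) (hw : w ≠ u) :
    vertex K G w * pathAux K G u l = 0 := by
  rw [← vertex_mul_pathAux K h, ← mul_assoc, vertex_mul_of_ne K G hw, zero_mul]

theorem pathAux_mul_vertex_of_ne {u v w : V} {l : List W} (h : G.IsPath u l v) (hw : v ≠ w) :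
    pathAux K G u l * vertex K G w = 0 := by
  rw [← pathAux_mul_vertex K h, mul_assoc, vertex_mul_of_ne K G hw, mul_zero]

theorem ghostPathAux_mul_vertex_of_ne {u v w : V} {l : List W} (h : G.IsPath u l v)
    (hw : u ≠ w) : ghostPathAux K G u l * vertex K G w = 0 := by
  rw [← ghostPathAux_mul_vertex K h, mul_assoc, vertex_mul_of_ne K G hw, mul_zero]

theorem pathAux_append {u v w : V} {l l' : List W} (h : G.IsPath u l v) (h' : G.IsPath v l' w) :
    pathAux K G u (l ++ l') = pathAux K G u l * pathAux K G v l' := by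
  induction l generalizing u with
  | nil => obtain rfl : u = v := h; exact (vertex_mul_pathAux K h').symm
  | cons e l ih => rw [List.cons_append, pathAux, ih h.2, pathAux, mul_assoc]

theorem ghostPathAux_append {u v w : V} {l l' : List W} (h : G.IsPath u l v)
    (h' : G.IsPath v l' w) :
    ghostPathAux K G u (l ++ l') = ghostPathAux K G v l' * ghostPathAux K G u l := by
  induction l generalizing u with
  | nil => obtain rfl : u = v := h; exact (ghostPathAux_mul_vertex K h').symm
  | cons e l ih => rw [List.cons_append, ghostPathAux, ih h.2, ghostPathAux, mul_assoc]

theorem pathAux_mul_ghostPathAux_of_ne {u v u' v' : V} {l l' : List W} (h : G.IsPath u l v)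
    (h' : G.IsPath u' l' v') (hv : v ≠ v') : pathAux K G u l * ghostPathAux K G u' l' = 0 := by
  rw [← vertex_mul_ghostPathAux K h', ← mul_assoc, pathAux_mul_vertex_of_ne K h hv, zero_mul]

theorem ghostPathAux_mul_pathAux_self {u v : V} {l : List W} (h : G.IsPath u l v) :
    ghostPathAux K G u l * pathAux K G u l = vertex K G v := by
  induction l generalizing u with
  | nil => obtain rfl : u = v := h; exact vertex_mul_self K G u
  | cons e l ih =>
    rw [pathAux, ghostPathAux, mul_assoc, ← mul_assoc (ghost K G e), ghost_mul_edge_self,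
      vertex_mul_pathAux K h.2, ih h.2]

/-- A ghost path times a path is zero unless one of the paths is a prefix of the other. -/
theorem ghostPathAux_mul_pathAux {u v u' v' : V} {l l' : List W} (h : G.IsPath u l v)
    (h' : G.IsPath u' l' v') :
    (∃ σ, u = u' ∧ l' = l ++ σ ∧ G.IsPath v σ v' ∧
        ghostPathAux K G u l * pathAux K G u' l' = pathAux K G v σ) ∨
      (∃ σ, u = u' ∧ l = l' ++ σ ∧ G.IsPath v' σ v ∧
        ghostPathAux K G u l * pathAux K G u' l' = ghostPathAux K G v' σ) ∨
      ghostPathAux K G u l * pathAux K G u' l' = 0 := by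
  induction l generalizing u u' l' with
  | nil =>
    obtain rfl : u = v := h
    by_cases hu : u = u'
    · subst hu
      exact Or.inl ⟨l', rfl, rfl, h', vertex_mul_pathAux K h'⟩
    · exact Or.inr (Or.inr (vertex_mul_pathAux_of_ne K h' hu))
  | cons e l ih =>
    cases l' with
    | nil =>
      obtain rfl : u' = v' := h'
      by_cases hu : u = u'
      · subst hu
        exact Or.inr (Or.inl ⟨e :: l, rfl, rfl, h, ghostPathAux_mul_vertex K h⟩)
      · exact Or.inr (Or.inr (ghostPathAux_mul_vertex_of_ne K h hu))
    | cons f l' =>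
      by_cases hef : e = f
      · subst hef
        have heq : ghostPathAux K G u (e :: l) * pathAux K G u' (e :: l') =
            ghostPathAux K G (G.tgt e) l * pathAux K G (G.tgt e) l' := by
          rw [pathAux, ghostPathAux, mul_assoc, ← mul_assoc (ghost K G e), ghost_mul_edge_self,
            vertex_mul_pathAux K h'.2]
        rw [heq]
        have huu : u = u' := h.1.symm.trans h'.1
        rcases ih h.2 h'.2 with ⟨σ, -, rfl, hσ, h₁⟩ | ⟨σ, -, rfl, hσ, h₁⟩ | h₁
        · exact Or.inl ⟨σ, huu, rfl, hσ, h₁⟩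
        · exact Or.inr (Or.inl ⟨σ, huu, rfl, hσ, h₁⟩)
        · exact Or.inr (Or.inr h₁)
      · refine Or.inr (Or.inr ?_)
        rw [pathAux, ghostPathAux, mul_assoc, ← mul_assoc (ghost K G e),
          ghost_mul_edge_of_ne K G hef, zero_mul, mul_zero]

/-- A path without bifurcations satisfies `α α* = s(α)`. -/
theorem pathAux_mul_ghostPathAux_self {u v : V} {l : List W} (h : G.IsPath u l v)
    (hl : ∀ e ∈ l, ¬ G.IsBifurcation (G.src e)) :
    pathAux K G u l * ghostPathAux K G u l = vertex K G u := by
  induction l generalizing u with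
  | nil => obtain rfl : u = v := h; exact vertex_mul_self K G u
  | cons e l ih =>
    rw [List.forall_mem_cons] at hl
    rw [pathAux, ghostPathAux, mul_assoc, ← mul_assoc (pathAux _ _ _ _), ih h.2 hl.2,
      tgt_mul_ghost, edge_mul_ghost_self K hl.1, h.1]

theorem pathAux_mul_ghostPathAux_of_isStraight {u v : V} {l : List W} (h : G.IsPath u l v)
    (hu : G.IsStraight u) : pathAux K G u l * ghostPathAux K G u l = vertex K G u :=
  pathAux_mul_ghostPathAux_self K h fun _ he => hu _ (h.src_mem_tree he)

/-! ### The grading -/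

theorem pathAux_mul_ghostPathAux_mem_grade {u v u' v' : V} {l l' : List W} (h : G.IsPath u l v)
    (h' : G.IsPath u' l' v') {n : ℤ} (hn : (l.length : ℤ) - l'.length = n) :
    pathAux K G u l * ghostPathAux K G u' l' ∈ grade K G n :=
  Submodule.subset_span ⟨⟨u, l, v, h⟩, ⟨u', l', v', h'⟩, hn, rfl⟩

theorem pathAux_mem_grade {u v : V} {l : List W} (h : G.IsPath u l v) :
    pathAux K G u l ∈ grade K G l.length := by
  rw [← pathAux_mul_vertex K h]
  exact pathAux_mul_ghostPathAux_mem_grade K (l' := []) h (rfl : v = v) (by simp)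

theorem ghostPathAux_mem_grade {u v : V} {l : List W} (h : G.IsPath u l v) :
    ghostPathAux K G u l ∈ grade K G (-(l.length : ℤ)) := by
  rw [← vertex_mul_ghostPathAux K h]
  exact pathAux_mul_ghostPathAux_mem_grade K (l := []) (rfl : v = v) h (by simp)

theorem vertex_mem_grade (v : V) : vertex K G v ∈ grade K G 0 :=
  pathAux_mem_grade K (l := []) (rfl : v = v)

variable {K} in
theorem mul_mem_grade {m n : ℤ} {a b : G.LeavittPathAlgebra K} (ha : a ∈ grade K G m)
    (hb : b ∈ grade K G n) : a * b ∈ grade K G (m + n) := by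
  induction ha using Submodule.span_induction with
  | zero => rw [zero_mul]; exact zero_mem _
  | add x y _ _ hx hy => rw [add_mul]; exact add_mem hx hy
  | smul k x _ hx => rw [smul_mul_assoc]; exact Submodule.smul_mem _ _ hx
  | mem x hx =>
    obtain ⟨⟨u₁, l₁, v₁, h₁⟩, ⟨u₂, l₂, v₂, h₂⟩, hm, rfl⟩ := hx
    induction hb using Submodule.span_induction with
    | zero => rw [mul_zero]; exact zero_mem _
    | add x y _ _ hx hy => rw [mul_add]; exact add_mem hx hy
    | smul k x _ hx => rw [mul_smul_comm]; exact Submodule.smul_mem _ _ hx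
    | mem y hy =>
      obtain ⟨⟨u₃, l₃, v₃, h₃⟩, ⟨u₄, l₄, v₄, h₄⟩, hn, rfl⟩ := hy
      simp only [path, ghostPath, Path.length] at hm hn ⊢
      by_cases hv : v₁ = v₂
      swap
      · rw [pathAux_mul_ghostPathAux_of_ne K h₁ h₂ hv, zero_mul]; exact zero_mem _
      by_cases hv' : v₃ = v₄
      swap
      · rw [pathAux_mul_ghostPathAux_of_ne K h₃ h₄ hv', mul_zero]; exact zero_mem _
      subst hv hv'
      rw [mul_assoc, ← mul_assoc (ghostPathAux K G u₂ l₂)]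
      rcases ghostPathAux_mul_pathAux K h₂ h₃ with
        ⟨σ, rfl, rfl, hσ, h⟩ | ⟨σ, rfl, rfl, hσ, h⟩ | h
      · rw [h, ← mul_assoc, ← pathAux_append K h₁ hσ]
        refine pathAux_mul_ghostPathAux_mem_grade K (h₁.append hσ) h₄ ?_
        push_cast [List.length_append] at hm hn ⊢
        omega
      · rw [h, ← ghostPathAux_append K h₄ hσ]
        refine pathAux_mul_ghostPathAux_mem_grade K h₁ (h₄.append hσ) ?_
        push_cast [List.length_append] at hm hn ⊢
        omega
      · rw [h, zero_mul, mul_zero]; exact zero_mem _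

theorem iSup_mul_mem {a b : G.LeavittPathAlgebra K} (ha : a ∈ ⨆ n, grade K G n)
    (hb : b ∈ ⨆ n, grade K G n) : a * b ∈ ⨆ n, grade K G n := by
  induction ha using Submodule.iSup_induction' with
  | zero => rw [zero_mul]; exact zero_mem _
  | add x y _ _ hx hy => rw [add_mul]; exact add_mem hx hy
  | mem m x hx =>
    induction hb using Submodule.iSup_induction' with
    | zero => rw [mul_zero]; exact zero_mem _
    | add x y _ _ hx hy => rw [mul_add]; exact add_mem hx hy
    | mem n y hy => exact Submodule.mem_iSup_of_mem (m + n) (mul_mem_grade hx hy)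

variable (G) in
-- The sum of the components is closed under products and contains all generators, hence all words.
-- Only spanning is claimed; where independence would be used, `exists_linear_form` serves instead.
theorem iSup_grade : ⨆ n, grade K G n = ⊤ := by
  refine eq_top_iff.2 fun a _ => ?_
  obtain ⟨x, rfl⟩ := mkAdd_surjective K G a
  have key : ∀ g : FreeSemigroup (LeavittGen V W),
      mkAdd K G (MonoidAlgebra.single g 1) ∈ ⨆ n, grade K G n := by
    intro g
    induction g using FreeSemigroup.recOnMul with
    | ih1 g =>
      cases g with
      | vertex v => exact Submodule.mem_iSup_of_mem _ (vertex_mem_grade K v)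
      | edge e =>
        refine Submodule.mem_iSup_of_mem (([e] : List W).length : ℤ) ?_
        have := pathAux_mem_grade K (isPath_singleton (G := G) e)
        rwa [pathAux, pathAux, edge_mul_tgt] at this
      | ghost e =>
        refine Submodule.mem_iSup_of_mem (-(([e] : List W).length : ℤ)) ?_
        have := ghostPathAux_mem_grade K (isPath_singleton (G := G) e)
        rwa [ghostPathAux, ghostPathAux, tgt_mul_ghost] at this
    | ih2 g h hg hh =>
      have : (MonoidAlgebra.single (FreeSemigroup.of g * h) 1 : LeavittFree K V W) =
          MonoidAlgebra.single (FreeSemigroup.of g) 1 * MonoidAlgebra.single h 1 := by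
        rw [MonoidAlgebra.single_mul_single, one_mul]
      rw [this, mkAdd_mul]
      exact iSup_mul_mem K hg hh
  induction x using MonoidAlgebra.induction_linear with
  | zero => rw [map_zero]; exact zero_mem _
  | add x y hx hy =>
    rw [map_add]; exact add_mem (hx trivial) (hy trivial)
  | single g k =>
    have : (MonoidAlgebra.single g k : LeavittFree K V W) = k • MonoidAlgebra.single g 1 := by
      rw [MonoidAlgebra.smul_single, smul_eq_mul, mul_one]
    rw [this, mkAdd_smul]
    exact Submodule.smul_mem _ _ (key g)

variable {K} in
/-- The Leavitt path algebra is spanned by the elements `α β*` with `r(α) = r(β)`. -/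
theorem induction_on {P : G.LeavittPathAlgebra K → Prop} (a : G.LeavittPathAlgebra K)
    (zero : P 0) (add : ∀ a b, P a → P b → P (a + b)) (smul : ∀ (k : K) (a), P a → P (k • a))
    (mem : ∀ {u u' v : V} {l l' : List W}, G.IsPath u l v → G.IsPath u' l' v →
      P (pathAux K G u l * ghostPathAux K G u' l')) : P a := by
  have ha : a ∈ ⨆ n, grade K G n := by rw [iSup_grade]; trivial
  induction ha using Submodule.iSup_induction' with
  | zero => exact zero
  | add x y _ _ hx hy => exact add x y hx hy
  | mem n x hx =>
    induction hx using Submodule.span_induction with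
    | zero => exact zero
    | add x y _ _ hx hy => exact add x y hx hy
    | smul k x _ hx => exact smul k x hx
    | mem x hx =>
      obtain ⟨⟨u, l, v, h⟩, ⟨u', l', v', h'⟩, -, rfl⟩ := hx
      by_cases hv : v = v'
      · subst hv
        exact mem h h'
      · simp only [path, ghostPath]
        rw [pathAux_mul_ghostPathAux_of_ne K h h' hv]
        exact zero

/-! ### Local units -/

variable {K} in
theorem exists_local_left_unit (a : G.LeavittPathAlgebra K) : ∃ b, b * a = a := by
  classical
  -- Asking for the identity on all larger finite sets too allows the sets of two summands to be
  -- merged.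
  suffices H : ∃ F : Finset V, ∀ F', F ⊆ F' → (∑ v ∈ F', vertex K G v) * a = a by
    obtain ⟨F, hF⟩ := H
    exact ⟨_, hF F subset_rfl⟩
  induction a using induction_on with
  | zero => exact ⟨∅, fun F' _ => mul_zero _⟩
  | add a b ha hb =>
    obtain ⟨F, hF⟩ := ha
    obtain ⟨F', hF'⟩ := hb
    refine ⟨F ∪ F', fun F'' h => ?_⟩
    rw [mul_add, hF _ (Finset.union_subset_left h), hF' _ (Finset.union_subset_right h)]
  | smul k a ha =>
    obtain ⟨F, hF⟩ := ha
    exact ⟨F, fun F' h => by rw [mul_smul_comm, hF F' h]⟩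
  | mem h h' =>
    rename_i u u' v l l'
    refine ⟨{u}, fun F' hF => ?_⟩
    rw [← mul_assoc, Finset.sum_mul,
      Finset.sum_eq_single u (fun w _ hw => vertex_mul_pathAux_of_ne K h hw)
        (fun hu => absurd (hF (Finset.mem_singleton_self u)) hu), vertex_mul_pathAux K h]

variable {K} in
theorem exists_mul_vertex_ne_zero {a : G.LeavittPathAlgebra K} (ha : a ≠ 0) :
    ∃ v, a * vertex K G v ≠ 0 := by
  classical
  by_contra! hall
  suffices H : ∃ F : Finset V, ∀ F', F ⊆ F' → a * (∑ v ∈ F', vertex K G v) = a by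
    obtain ⟨F, hF⟩ := H
    refine ha ?_
    rw [← hF F subset_rfl, Finset.mul_sum]
    exact Finset.sum_eq_zero fun v _ => hall v
  clear hall ha
  induction a using induction_on with
  | zero => exact ⟨∅, fun F' _ => zero_mul _⟩
  | add a b ha hb =>
    obtain ⟨F, hF⟩ := ha
    obtain ⟨F', hF'⟩ := hb
    refine ⟨F ∪ F', fun F'' h => ?_⟩
    rw [add_mul, hF _ (Finset.union_subset_left h), hF' _ (Finset.union_subset_right h)]
  | smul k a ha =>
    obtain ⟨F, hF⟩ := ha
    exact ⟨F, fun F' h => by rw [smul_mul_assoc, hF F' h]⟩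
  | mem h h' =>
    rename_i u u' v l l'
    refine ⟨{u'}, fun F' hF => ?_⟩
    rw [mul_assoc, Finset.mul_sum,
      Finset.sum_eq_single u' (fun w _ hw => ghostPathAux_mul_vertex_of_ne K h' hw.symm)
        (fun hu => absurd (hF (Finset.mem_singleton_self u')) hu), ghostPathAux_mul_vertex K h']

end DirGraph.LeavittPathAlgebra
end

noncomputable section
namespace DirGraph.LeavittPathAlgebra

variable {V W : Type*} (K : Type*) [Field K] (G : DirGraph V W)

/-! ### A graded representation in which no vertex acts as zero -/

/-- There is a set `C` such that for every vertex `v` that emits an edge, the set `C` is in bijection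
with the set of pairs of an edge emitted by `v` and an element of `C`. -/
theorem exists_branching :
    ∃ (head : V → W ⊕ ℕ → Option W) (tail : V → W ⊕ ℕ → W ⊕ ℕ) (cons : W → W ⊕ ℕ → W ⊕ ℕ),
      (∀ e c, head (G.src e) (cons e c) = some e) ∧ (∀ e c, tail (G.src e) (cons e c) = c) ∧
      (∀ v c e, head v c = some e → G.src e = v ∧ cons e (tail v c) = c) ∧
      ∀ e c, ∃ f, head (G.src e) c = some f := by
  classical
  -- `W ⊕ ℕ` is infinite and at least as large as any set of edges, so taking its product with a
  -- nonempty set of edges does not change its cardinality.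
  have H : ∀ v, (∃ e, G.src e = v) → Nonempty ({e // G.src e = v} × (W ⊕ ℕ) ≃ W ⊕ ℕ) := by
    rintro v ⟨e, he⟩
    refine Cardinal.eq.1 ?_
    rw [← Cardinal.mul_def]
    refine Cardinal.mul_eq_right (Cardinal.aleph0_le_mk _) ?_ ?_
    · exact Cardinal.mk_le_of_injective (f := fun x => Sum.inl x.1)
        fun x y h => Subtype.ext (Sum.inl_injective h)
    · exact Cardinal.mk_ne_zero_iff.2 ⟨⟨e, he⟩⟩
  let φ := fun v h => (H v h).some
  -- At a vertex that emits no edge the head is `none`; the value of the tail there is irrelevant.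
  refine ⟨fun v c => if h : ∃ e, G.src e = v then some ((φ v h).symm c).1.1 else none,
    fun v c => if h : ∃ e, G.src e = v then ((φ v h).symm c).2 else c,
    fun e c => φ (G.src e) ⟨e, rfl⟩ (⟨e, rfl⟩, c), ?_, ?_, ?_, ?_⟩
  · intro e c
    simp
  · intro e c
    simp
  · intro v c e h
    beta_reduce at h ⊢
    by_cases hv : ∃ e, G.src e = v
    · rw [dif_pos hv, Option.some_inj] at h
      have hs := ((φ v hv).symm c).1.2
      rw [h] at hs
      subst hs
      refine ⟨rfl, ?_⟩
      rw [dif_pos hv]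
      conv_rhs => rw [← (φ (G.src e) hv).apply_symm_apply c]
      congr 1
      exact Prod.ext (Subtype.ext h.symm) rfl
    · rw [dif_neg hv] at h
      cases h
  · intro e c
    have h : ∃ f, G.src f = G.src e := ⟨e, rfl⟩
    exact ⟨_, dif_pos h⟩

variable {K G} in
-- The universal property of the presentation, through which concrete operators can certify that
-- elements of the quotient are nonzero.
theorem exists_lift {A : Type*} [NonUnitalRing A] [Module K A] [IsScalarTower K A A]
    [SMulCommClass K A A] (g : LeavittGen V W → A)
    (idem : ∀ v, g (.vertex v) * g (.vertex v) = g (.vertex v))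
    (orth : ∀ v w, v ≠ w → g (.vertex v) * g (.vertex w) = 0)
    (src_edge : ∀ e, g (.vertex (G.src e)) * g (.edge e) = g (.edge e))
    (edge_tgt : ∀ e, g (.edge e) * g (.vertex (G.tgt e)) = g (.edge e))
    (tgt_ghost : ∀ e, g (.vertex (G.tgt e)) * g (.ghost e) = g (.ghost e))
    (ghost_src : ∀ e, g (.ghost e) * g (.vertex (G.src e)) = g (.ghost e))
    (ck1_same : ∀ e, g (.ghost e) * g (.edge e) = g (.vertex (G.tgt e)))
    (ck1_ne : ∀ e f, e ≠ f → g (.ghost e) * g (.edge f) = 0)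
    (ck2 : ∀ (v : V) (h : G.IsRegular v),
      g (.vertex v) = ∑ e ∈ h.1.toFinset, g (.edge e) * g (.ghost e)) :
    ∃ ρ : G.LeavittPathAlgebra K →ₗ[K] A, (∀ a b, ρ (a * b) = ρ a * ρ b) ∧
      (∀ v, ρ (vertex K G v) = g (.vertex v)) ∧ (∀ e, ρ (edge K G e) = g (.edge e)) ∧
      ∀ e, ρ (ghost K G e) = g (.ghost e) := by
  let ρ₀ : LeavittFree K V W →ₙₐ[K] A := MonoidAlgebra.liftMagma K (FreeSemigroup.lift g)
  have hof : ∀ x, ρ₀ (LeavittFree.of K x) = g x := by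
    intro x
    simp only [ρ₀, LeavittFree.of, MonoidAlgebra.liftMagma_apply_apply]
    simp
  have hcon : ∀ x y, G.leavittCon K x y → ρ₀ x = ρ₀ y := by
    intro x y h
    change RingConGen.Rel _ _ _ at h
    induction h with
    | of x y h =>
      obtain ⟨k, a, b, hab, rfl, rfl⟩ := h
      rw [map_smul, map_smul]
      congr 1
      cases hab <;>
        simp only [LeavittFree.vertex, LeavittFree.edge, LeavittFree.ghost, map_mul, map_sum,
          map_zero, hof]
      · exact idem _
      · exact orth _ _ ‹_›
      · exact src_edge _
      · exact edge_tgt _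
      · exact tgt_ghost _
      · exact ghost_src _
      · exact ck1_same _
      · exact ck1_ne _ _ ‹_›
      · exact ck2 _ ‹_›
    | refl x => rfl
    | symm _ ih => exact ih.symm
    | trans _ _ ih₁ ih₂ => exact ih₁.trans ih₂
    | add _ _ ih₁ ih₂ => rw [map_add, map_add, ih₁, ih₂]
    | mul _ _ ih₁ ih₂ => rw [map_mul, map_mul, ih₁, ih₂]
  let r : G.LeavittPathAlgebra K → A := fun a => ρ₀ (Function.surjInv (mkAdd_surjective K G) a)
  have hr : ∀ x, r (mkAdd K G x) = ρ₀ x := fun x =>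
    hcon _ _ ((RingCon.eq (G.leavittCon K)).1 (Function.surjInv_eq (mkAdd_surjective K G) _))
  refine ⟨{ toFun := r, map_add' := ?_, map_smul' := ?_ }, ?_, ?_, ?_, ?_⟩
  · intro a b
    obtain ⟨x, rfl⟩ := mkAdd_surjective K G a
    obtain ⟨y, rfl⟩ := mkAdd_surjective K G b
    rw [← map_add, hr, hr, hr, map_add]
  · intro k a
    obtain ⟨x, rfl⟩ := mkAdd_surjective K G a
    rw [← mkAdd_smul, hr, hr, map_smul]
    rfl
  · intro a b
    obtain ⟨x, rfl⟩ := mkAdd_surjective K G a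
    obtain ⟨y, rfl⟩ := mkAdd_surjective K G b
    change r _ = r _ * r _
    rw [← mkAdd_mul, hr, hr, hr, map_mul]
  · exact fun v => (hr _).trans (hof _)
  · exact fun e => (hr _).trans (hof _)
  · exact fun e => (hr _).trans (hof _)

open Classical in
/-- For every vertex `v` there is a linear form that takes the value `1` at `v` and vanishes on the
homogeneous components of nonzero degree. -/
theorem exists_linear_form (v : V) :
    ∃ ε : G.LeavittPathAlgebra K →ₗ[K] K, ε (vertex K G v) = 1 ∧
      ∀ m ≠ 0, ∀ a ∈ grade K G m, ε a = 0 := by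
  obtain ⟨head, tail, cons, hcons, tcons, hhead, hne⟩ := exists_branching G
  -- A triple `(w, c, n)` behaves like an infinite path from `w` with a degree `n`: its first edge
  -- is `head w c` and the remainder is `tail w c`. On functions of such triples, `edge e` prepends
  -- `e` and raises the degree by one, and `ghost e` removes `e` and lowers it.
  let g : LeavittGen V W → Module.End K (V → W ⊕ ℕ → ℤ → K) := fun x =>
    match x with
    | .vertex v =>
      { toFun := fun f w c n => if w = v then f w c n else 0
        map_add' := fun f f' => by ext w c n; by_cases h : w = v <;> simp [h]
        map_smul' := fun k f => by ext w c n; by_cases h : w = v <;> simp [h] }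
    | .edge e =>
      { toFun := fun f w c n => if head w c = some e then f (G.tgt e) (tail w c) (n - 1) else 0
        map_add' := fun f f' => by ext w c n; by_cases h : head w c = some e <;> simp [h]
        map_smul' := fun k f => by ext w c n; by_cases h : head w c = some e <;> simp [h] }
    | .ghost e =>
      { toFun := fun f w c n => if w = G.tgt e then f (G.src e) (cons e c) (n + 1) else 0
        map_add' := fun f f' => by ext w c n; by_cases h : w = G.tgt e <;> simp [h]
        map_smul' := fun k f => by ext w c n; by_cases h : w = G.tgt e <;> simp [h] }
  have gv : ∀ v f w c n, g (.vertex v) f w c n = if w = v then f w c n else 0 :=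
    fun _ _ _ _ _ => rfl
  have ge : ∀ e f w c n, g (.edge e) f w c n =
      if head w c = some e then f (G.tgt e) (tail w c) (n - 1) else 0 := fun _ _ _ _ _ => rfl
  have gg : ∀ e f w c n, g (.ghost e) f w c n =
      if w = G.tgt e then f (G.src e) (cons e c) (n + 1) else 0 := fun _ _ _ _ _ => rfl
  refine Exists.elim (exists_lift (K := K) (G := G) g ?_ ?_ ?_ ?_ ?_ ?_ ?_ ?_ ?_) ?_
  · intro v; ext f w c n
    simp only [Module.End.mul_apply, gv]
    split_ifs <;> rfl
  · intro v v' hvv; ext f w c n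
    simp only [Module.End.mul_apply, gv]
    split_ifs with h h'
    · exact absurd (h.symm.trans h') hvv
    · rfl
    · rfl
  · intro e; ext f w c n
    simp only [Module.End.mul_apply, gv, ge]
    split_ifs with h h' h'
    · rfl
    · rfl
    · exact absurd (hhead _ _ _ h').1.symm h
    · rfl
  · intro e; ext f w c n
    simp only [Module.End.mul_apply, gv, ge, if_true]
  · intro e; ext f w c n
    simp only [Module.End.mul_apply, gv, gg]
    split_ifs <;> rfl
  · intro e; ext f w c n
    simp only [Module.End.mul_apply, gv, gg, if_true]
  · intro e; ext f w c n
    simp only [Module.End.mul_apply, gv, ge, gg, hcons, tcons, if_true, add_sub_cancel_right]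
    split_ifs with h
    · rw [h]
    · rfl
  · intro e e' hee; ext f w c n
    simp only [Module.End.mul_apply, ge, gg]
    have : head (G.src e) (cons e c) ≠ some e' := by
      rw [hcons]; simpa using hee
    simp [this]
  · intro v hv; ext f w c n
    simp only [LinearMap.sum_apply, Finset.sum_apply, Module.End.mul_apply, gv, ge, gg, if_true,
      sub_add_cancel]
    split_ifs with h
    · subst h
      obtain ⟨e₀, he₀⟩ := hv.2
      -- Each `c` has exactly one head at `w`, so exactly one summand of `ck2` survives.
      obtain ⟨e, he⟩ := hne e₀ c
      rw [show G.src e₀ = w from he₀] at he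
      obtain ⟨hs, hc⟩ := hhead _ _ _ he
      rw [Finset.sum_eq_single e, if_pos he, hc, hs]
      · intro e' _ hne'
        rw [if_neg]
        rw [he, Option.some_inj]
        exact hne'.symm
      · intro h
        exact absurd (hv.1.mem_toFinset.2 hs) h
    · refine (Finset.sum_eq_zero fun e he => if_neg fun h' => h ?_).symm
      rw [← (hhead _ _ _ h').1]
      exact hv.1.mem_toFinset.1 he
  rintro ρ ⟨ρmul, ρv, ρe, ρg⟩
  -- `D d f` says that `f` is concentrated in degree `d`; a path raises this degree by its length
  -- and a ghost path lowers it.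
  let D : ℤ → (V → W ⊕ ℕ → ℤ → K) → Prop := fun d f => ∀ w c n, n ≠ d → f w c n = 0
  have Dpath : ∀ (u : V) (l : List W) d f, D d f → D (l.length + d) (ρ (pathAux K G u l) f) := by
    intro u l
    induction l generalizing u with
    | nil =>
      intro d f hf w c n hn
      rw [pathAux, ρv, gv, hf w c n (by simpa using hn), ite_self]
    | cons e l ih =>
      intro d f hf w c n hn
      rw [pathAux, ρmul, Module.End.mul_apply, ρe, ge, ih _ d f hf _ _ (n - 1), ite_self]
      push_cast [List.length_cons] at hn
      omega
  have Dghost : ∀ (u : V) (l : List W) d f, D d f →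
      D (-l.length + d) (ρ (ghostPathAux K G u l) f) := by
    intro u l
    induction l generalizing u with
    | nil =>
      intro d f hf w c n hn
      rw [ghostPathAux, ρv, gv, hf w c n (by simpa using hn), ite_self]
    | cons e l ih =>
      intro d f hf
      have h1 : D (-1 + d) (g (.ghost e) f) := by
        intro w c n hn
        rw [gg, hf _ _ _ (by omega), ite_self]
      have h2 := ih (G.tgt e) _ _ h1
      rw [ghostPathAux, ρmul, Module.End.mul_apply, ρg]
      rwa [← add_assoc, ← neg_add, ← Nat.cast_succ] at h2
  -- The form evaluates `a f₀` at `(v, inr 0, 0)`, where `inr 0` is an arbitrary point. An element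
  -- of nonzero degree moves `f₀` out of degree `0`, so the value is then zero.
  let f₀ : V → W ⊕ ℕ → ℤ → K := fun _ _ n => if n = 0 then 1 else 0
  have hf₀ : D 0 f₀ := fun w c n hn => if_neg hn
  refine ⟨{ toFun := fun a => ρ a f₀ v (Sum.inr 0) 0, map_add' := ?_, map_smul' := ?_ }, ?_, ?_⟩
  · intro a b
    rw [map_add]; rfl
  · intro k a
    rw [map_smul]; rfl
  · change ρ (vertex K G v) f₀ v (Sum.inr 0) 0 = 1
    rw [ρv, gv, if_pos rfl]
    exact if_pos rfl
  · intro m hm a ha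
    change ρ a f₀ v (Sum.inr 0) 0 = 0
    induction ha using Submodule.span_induction with
    | zero => rw [map_zero]; rfl
    | add x y _ _ hx hy =>
      rw [map_add]
      change ρ x f₀ v _ 0 + ρ y f₀ v _ 0 = 0
      rw [hx, hy, add_zero]
    | smul k x _ hx =>
      rw [map_smul]
      change k * ρ x f₀ v _ 0 = 0
      rw [hx, mul_zero]
    | mem x hx =>
      obtain ⟨α, β, hn, rfl⟩ := hx
      rw [ρmul, Module.End.mul_apply]
      refine Dpath _ _ _ _ (Dghost _ _ _ _ hf₀) _ _ _ ?_
      simp only [Path.length] at hn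
      omega

theorem vertex_ne_zero (v : V) : vertex K G v ≠ 0 := by
  obtain ⟨ε, hε, -⟩ := exists_linear_form K G v
  intro h
  rw [h, map_zero] at hε
  exact zero_ne_one hε

variable {G} in
theorem pathAux_ne_zero {u v : V} {l : List W} (h : G.IsPath u l v) : pathAux K G u l ≠ 0 := by
  intro h0
  refine vertex_ne_zero K G v ?_
  rw [← ghostPathAux_mul_pathAux_self K h, h0, mul_zero]

variable {G} in
theorem ghostPathAux_ne_zero {u v : V} {l : List W} (h : G.IsPath u l v) :
    ghostPathAux K G u l ≠ 0 := by
  intro h0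
  refine vertex_ne_zero K G v ?_
  rw [← ghostPathAux_mul_pathAux_self K h, h0, zero_mul]

end DirGraph.LeavittPathAlgebra
end

noncomputable section
namespace DirGraph.LeavittPathAlgebra

variable {V W : Type*} (K : Type*) [Field K] (G : DirGraph V W)

/-! ### The reduction theorem for homogeneous elements -/

/-- The span of the paths of length `n` that end at `v`. -/
def pathSpan (n : ℤ) (v : V) : Submodule K (G.LeavittPathAlgebra K) :=
  Submodule.span K {x | ∃ u l, G.IsPath u l v ∧ (l.length : ℤ) = n ∧ x = pathAux K G u l}

/-- The span of the elements `α β*` of degree `n` with `|β| ≤ N`. -/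
def boundedGrade (N : ℕ) (n : ℤ) : Submodule K (G.LeavittPathAlgebra K) :=
  Submodule.span K {x | ∃ u l u' l' v, G.IsPath u l v ∧ G.IsPath u' l' v ∧ l'.length ≤ N ∧
    (l.length : ℤ) - l'.length = n ∧ x = pathAux K G u l * ghostPathAux K G u' l'}

theorem boundedGrade_mono (n : ℤ) {N N' : ℕ} (h : N ≤ N') :
    boundedGrade K G N n ≤ boundedGrade K G N' n := by
  refine Submodule.span_mono ?_
  rintro x ⟨u, l, u', l', v, h₁, h₂, h₃, h₄⟩
  exact ⟨u, l, u', l', v, h₁, h₂, h₃.trans h, h₄⟩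

variable {K G}

theorem exists_mem_boundedGrade {n : ℤ} {a : G.LeavittPathAlgebra K} (ha : a ∈ grade K G n) :
    ∃ N, a ∈ boundedGrade K G N n := by
  induction ha using Submodule.span_induction with
  | zero => exact ⟨0, zero_mem _⟩
  | add x y _ _ hx hy =>
    obtain ⟨N, hN⟩ := hx
    obtain ⟨N', hN'⟩ := hy
    exact ⟨max N N', add_mem (boundedGrade_mono K G n (le_max_left _ _) hN)
      (boundedGrade_mono K G n (le_max_right _ _) hN')⟩
  | smul k x _ hx =>
    obtain ⟨N, hN⟩ := hx
    exact ⟨N, Submodule.smul_mem _ _ hN⟩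
  | mem x hx =>
    obtain ⟨⟨u, l, v, h⟩, ⟨u', l', v', h'⟩, hn, rfl⟩ := hx
    by_cases hv : v = v'
    · subst hv
      exact ⟨l'.length, Submodule.subset_span ⟨u, l, u', l', v, h, h', le_rfl, hn, rfl⟩⟩
    · refine ⟨0, ?_⟩
      simp only [path, ghostPath]
      rw [pathAux_mul_ghostPathAux_of_ne K h h' hv]
      exact zero_mem _

/-- The rightmost factor of `β*` is the ghost of the first edge of `β`, which `e` either cancels or
annihilates; if `β` is trivial, `e` prolongs `α` or gives zero. The drop in the bound drives the
induction in `exists_reduction`. -/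
theorem mul_edge_mem_boundedGrade {N : ℕ} {n : ℤ} {a : G.LeavittPathAlgebra K}
    (ha : a ∈ boundedGrade K G (N + 1) n) (e : W) :
    a * edge K G e ∈ boundedGrade K G N (n + 1) := by
  induction ha using Submodule.span_induction with
  | zero => rw [zero_mul]; exact zero_mem _
  | add x y _ _ hx hy => rw [add_mul]; exact add_mem hx hy
  | smul k x _ hx => rw [smul_mul_assoc]; exact Submodule.smul_mem _ _ hx
  | mem x hx =>
    obtain ⟨u, l, u', l', v, h, h', hN, hn, rfl⟩ := hx
    cases l' with
    | nil =>
      obtain rfl : u' = v := h'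
      by_cases hu : G.src e = u'
      · subst hu
        refine Submodule.subset_span ⟨u, l ++ [e], G.tgt e, [], G.tgt e,
          h.append (isPath_singleton e), rfl, Nat.zero_le _, ?_, ?_⟩
        · push_cast [List.length_append, List.length_nil, List.length_singleton] at hn ⊢
          omega
        · rw [pathAux_append K h (isPath_singleton e), ghostPathAux, ghostPathAux, mul_assoc,
            mul_assoc, pathAux_mul_vertex K (isPath_singleton e), pathAux, pathAux, edge_mul_tgt,
            src_mul_edge]
      · rw [ghostPathAux, mul_assoc, ← src_mul_edge, ← mul_assoc (vertex K G u'),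
          vertex_mul_of_ne K G (Ne.symm hu), zero_mul, mul_zero]
        exact zero_mem _
    | cons f l' =>
      by_cases hf : f = e
      · subst hf
        refine Submodule.subset_span ⟨u, l, G.tgt f, l', v, h, h'.2, by simpa using hN, ?_, ?_⟩
        · push_cast [List.length_cons] at hn ⊢
          omega
        · rw [ghostPathAux, mul_assoc, mul_assoc, ghost_mul_edge_self,
            ghostPathAux_mul_vertex K h'.2]
      · rw [ghostPathAux, mul_assoc, mul_assoc, ghost_mul_edge_of_ne K G hf, mul_zero, mul_zero]
        exact zero_mem _

theorem mul_vertex_mem_pathSpan {n : ℤ} {a : G.LeavittPathAlgebra K}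
    (ha : a ∈ boundedGrade K G 0 n) (v : V) : a * vertex K G v ∈ pathSpan K G n v := by
  induction ha using Submodule.span_induction with
  | zero => rw [zero_mul]; exact zero_mem _
  | add x y _ _ hx hy => rw [add_mul]; exact add_mem hx hy
  | smul k x _ hx => rw [smul_mul_assoc]; exact Submodule.smul_mem _ _ hx
  | mem x hx =>
    obtain ⟨u, l, u', l', w, h, h', hN, hn, rfl⟩ := hx
    obtain rfl := List.eq_nil_of_length_eq_zero (Nat.le_zero.1 hN)
    obtain rfl : u' = w := h'
    rw [ghostPathAux, pathAux_mul_vertex K h]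
    by_cases hv : u' = v
    · subst hv
      rw [pathAux_mul_vertex K h]
      exact Submodule.subset_span ⟨u, l, h, by simpa using hn, rfl⟩
    · rw [pathAux_mul_vertex_of_ne K h hv]
      exact zero_mem _

/-- A nonzero combination of paths of the same length can be reduced to a vertex from the left. -/
theorem exists_reduction_of_mem_pathSpan {n : ℤ} {v : V} {a : G.LeavittPathAlgebra K}
    (ha : a ∈ pathSpan K G n v) (ha0 : a ≠ 0) :
    ∃ u l, G.IsPath u l v ∧ ∃ k : K, k ≠ 0 ∧ ghostPathAux K G u l * a = k • vertex K G v := by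
  have hset : {x | ∃ u l, G.IsPath u l v ∧ (l.length : ℤ) = n ∧ x = pathAux K G u l} =
      Set.range fun p : {p : V × List W // G.IsPath p.1 p.2 v ∧ (p.2.length : ℤ) = n} =>
        pathAux K G p.1.1 p.1.2 := by
    ext x
    constructor
    · rintro ⟨u, l, h, hn, rfl⟩
      exact ⟨⟨(u, l), h, hn⟩, rfl⟩
    · rintro ⟨⟨⟨u, l⟩, h, hn⟩, rfl⟩
      exact ⟨u, l, h, hn, rfl⟩
  rw [pathSpan, hset, Finsupp.mem_span_range_iff_exists_finsupp] at ha
  obtain ⟨c, rfl⟩ := ha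
  have hc : c ≠ 0 := by
    rintro rfl
    exact ha0 Finsupp.sum_zero_index
  obtain ⟨p, hp⟩ := Finsupp.ne_iff.1 hc
  -- Any path `p` with nonzero coefficient will do: `p*` kills the others, because distinct paths of
  -- equal length are not prefixes of one another.
  refine ⟨p.1.1, p.1.2, p.2.1, c p, hp, ?_⟩
  rw [Finsupp.mul_sum, Finsupp.sum, Finset.sum_eq_single p]
  · rw [mul_smul_comm, ghostPathAux_mul_pathAux_self K p.2.1]
  · intro q _ hq
    rw [mul_smul_comm]
    have hlen : p.1.2.length = q.1.2.length := by
      have := p.2.2.trans q.2.2.symm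
      exact_mod_cast this
    rcases ghostPathAux_mul_pathAux K p.2.1 q.2.1 with
      ⟨σ, hs, hl, -, -⟩ | ⟨σ, hs, hl, -, -⟩ | h
    · have : σ = [] := List.eq_nil_of_length_eq_zero (by simp [hl] at hlen; simp [hlen])
      exact absurd (Subtype.ext (Prod.ext hs.symm (by simp [hl, this]))) hq
    · have : σ = [] := List.eq_nil_of_length_eq_zero (by simp [hl] at hlen; simp [hlen])
      exact absurd (Subtype.ext (Prod.ext hs.symm (by simp [hl, this]))) hq
    · rw [h, smul_zero]
  · intro h
    exact absurd (Finsupp.mem_support_iff.2 hp) h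

/-- The part of `a v` in which no ghost edges occur, and the rest, on which a finite sum of
projections `e e*` acts as a unit. -/
theorem exists_decomposition {N : ℕ} {n : ℤ} {a : G.LeavittPathAlgebra K}
    (ha : a ∈ boundedGrade K G N n) (v : V) :
    ∃ b₀ ∈ pathSpan K G n v, ∃ b₁, a * vertex K G v = b₀ + b₁ ∧ b₁ * vertex K G v = b₁ ∧
      ∃ F : Finset W, ∀ F', F ⊆ F' → ∑ e ∈ F', b₁ * edge K G e * ghost K G e = b₁ := by
  classical
  induction ha using Submodule.span_induction with
  | zero =>
    exact ⟨0, zero_mem _, 0, by simp, zero_mul _, ∅, fun F' _ => by simp⟩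
  | add x y _ _ hx hy =>
    obtain ⟨b₀, hb₀, b₁, h₁, h₂, F, hF⟩ := hx
    obtain ⟨c₀, hc₀, c₁, h₃, h₄, F', hF'⟩ := hy
    refine ⟨b₀ + c₀, add_mem hb₀ hc₀, b₁ + c₁, ?_, ?_, F ∪ F', fun F'' h => ?_⟩
    · rw [add_mul, h₁, h₃, add_add_add_comm]
    · rw [add_mul, h₂, h₄]
    · simp only [add_mul, Finset.sum_add_distrib]
      rw [hF _ (Finset.union_subset_left h), hF' _ (Finset.union_subset_right h)]
  | smul k x _ hx =>
    obtain ⟨b₀, hb₀, b₁, h₁, h₂, F, hF⟩ := hx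
    refine ⟨k • b₀, Submodule.smul_mem _ _ hb₀, k • b₁, ?_, ?_, F, fun F' h => ?_⟩
    · rw [smul_mul_assoc, h₁, smul_add]
    · rw [smul_mul_assoc, h₂]
    · simp only [smul_mul_assoc, ← Finset.smul_sum]
      rw [hF _ h]
  | mem x hx =>
    obtain ⟨u, l, u', l', w, h, h', hN, hn, rfl⟩ := hx
    cases l' with
    | nil =>
      refine ⟨_, mul_vertex_mem_pathSpan (Submodule.subset_span
        ⟨u, l, u', [], w, h, h', le_rfl, hn, rfl⟩) v, 0, (add_zero _).symm, zero_mul _, ∅,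
          fun F' _ => by simp⟩
    | cons f l' =>
      by_cases hv : u' = v
      · subst hv
        -- The last factor of `β*` is `f*`, and `f* e e*` equals `f*` for `e = f` and zero
        -- otherwise; hence `{f}` and every larger set work.
        refine ⟨0, zero_mem _, _, (zero_add _).symm, ?_, {f}, fun F' hF => ?_⟩
        · rw [mul_assoc, vertex_mul_self]
        · rw [mul_assoc, ghostPathAux_mul_vertex K h', Finset.sum_eq_single f]
          · rw [ghostPathAux, mul_assoc, mul_assoc, mul_assoc, ← mul_assoc (ghost K G f),
              ghost_mul_edge_self, tgt_mul_ghost]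
          · intro e _ he
            rw [ghostPathAux, mul_assoc, mul_assoc, mul_assoc, ← mul_assoc (ghost K G f),
              ghost_mul_edge_of_ne K G he.symm, zero_mul, mul_zero, mul_zero]
          · intro hf
            exact absurd (hF (Finset.mem_singleton_self f)) hf
      · refine ⟨0, zero_mem _, 0, ?_, zero_mul _, ∅, fun F' _ => by simp⟩
        rw [mul_assoc, ghostPathAux_mul_vertex_of_ne K h' hv, mul_zero, add_zero]

theorem edge_ne_zero (e : W) : edge K G e ≠ 0 := by
  intro h
  refine vertex_ne_zero K G (G.tgt e) ?_
  rw [← ghost_mul_edge_self, h, mul_zero]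

/-- If `a e = 0` for all edges `e`, then every `a v` is a combination of paths. -/
theorem mul_vertex_mem_pathSpan_of_mul_edge {N : ℕ} {n : ℤ} {a : G.LeavittPathAlgebra K}
    (ha : a ∈ boundedGrade K G N n) (hae : ∀ e, a * edge K G e = 0) (v : V) :
    a * vertex K G v ∈ pathSpan K G n v := by
  -- At a regular vertex `a v` is the sum of the `a e e*`, hence zero. What remains are infinite
  -- emitters and sinks, where `ck2` is not available.
  by_cases hreg : G.IsRegular v
  · rw [vertex_eq_sum K G hreg, Finset.mul_sum, Finset.sum_eq_zero]
    · exact zero_mem _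
    · intro e _
      rw [← mul_assoc, hae, zero_mul]
  obtain ⟨b₀, hb₀, b₁, hab, hb₁, F, hF⟩ := exists_decomposition ha v
  have hve : ∀ e, G.src e ≠ v → vertex K G v * edge K G e = 0 := by
    intro e he
    rw [← src_mul_edge, ← mul_assoc, vertex_mul_of_ne K G he.symm, zero_mul]
  have hbe : ∀ e, (b₀ + b₁) * edge K G e = 0 := by
    intro e
    rw [← hab, mul_assoc]
    by_cases he : G.src e = v
    · rw [← he, src_mul_edge, hae]
    · rw [hve e he, mul_zero]
  have hb₁0 : (∀ e, b₁ * edge K G e = 0) → b₁ = 0 := by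
    intro h
    rw [← hF F subset_rfl]
    exact Finset.sum_eq_zero fun e _ => by rw [h, zero_mul]
  by_cases hne : {e | G.src e = v}.Nonempty
  · have hinf : {e | G.src e = v}.Infinite := fun hfin => hreg ⟨hfin, hne⟩
    obtain ⟨f, hf, hfF⟩ := hinf.exists_notMem_finset F
    have hf : G.src f = v := hf
    have hb₁f : b₁ * edge K G f = 0 := by
      rw [← hF F subset_rfl, Finset.sum_mul]
      refine Finset.sum_eq_zero fun e he => ?_
      rw [mul_assoc, ghost_mul_edge_of_ne K G (fun h => hfF (by rw [← h]; exact he)), mul_zero]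
    have hb₀f : b₀ * edge K G f = 0 := by simpa [add_mul, hb₁f] using hbe f
    have hb₀0 : b₀ = 0 := by
      by_contra hne
      obtain ⟨u, l, -, k, hk, h⟩ := exists_reduction_of_mem_pathSpan hb₀ hne
      have h2 : k • edge K G f = 0 := by
        rw [← src_mul_edge, hf, ← smul_mul_assoc, ← h, mul_assoc, hb₀f, mul_zero]
      exact edge_ne_zero f ((smul_eq_zero.1 h2).resolve_left hk)
    rw [hab, hb₀0, hb₁0 fun e => by simpa [hb₀0] using hbe e, add_zero]
    exact zero_mem _
  -- At a sink `b₁ = b₁ v` is killed by every edge, so only the path part `b₀` remains.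
  · rw [hab, hb₁0, add_zero]
    · exact hb₀
    · intro e
      rw [← hb₁, mul_assoc, hve e fun he => hne ⟨e, he⟩, mul_zero]

/-- Every nonzero homogeneous element can be reduced to a vertex. -/
theorem exists_reduction {n : ℤ} {a : G.LeavittPathAlgebra K} (ha : a ∈ grade K G n)
    (ha0 : a ≠ 0) :
    ∃ u l u' l' v, G.IsPath u l v ∧ G.IsPath u' l' v ∧ ∃ k : K, k ≠ 0 ∧
      ghostPathAux K G u l * a * pathAux K G u' l' = k • vertex K G v := by
  obtain ⟨N, hN⟩ := exists_mem_boundedGrade ha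
  clear ha
  have base : ∀ (n : ℤ) (a : G.LeavittPathAlgebra K) (v : V), a * vertex K G v ≠ 0 →
      a * vertex K G v ∈ pathSpan K G n v →
      ∃ u l u' l' v, G.IsPath u l v ∧ G.IsPath u' l' v ∧ ∃ k : K, k ≠ 0 ∧
        ghostPathAux K G u l * a * pathAux K G u' l' = k • vertex K G v := by
    intro n a v hv h
    obtain ⟨u, l, hl, k, hk, h⟩ := exists_reduction_of_mem_pathSpan h hv
    exact ⟨u, l, v, [], v, hl, rfl, k, hk, by rw [pathAux, mul_assoc, h]⟩
  obtain ⟨v, hv⟩ := exists_mul_vertex_ne_zero ha0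
  induction N generalizing n a v with
  | zero => exact base n a v hv (mul_vertex_mem_pathSpan hN v)
  | succ N ih =>
    -- If some `a e` is nonzero, it has shorter ghost paths and induction applies, with `e` put in
    -- front of the right-hand path. Otherwise `a v` is already a combination of paths.
    by_cases hall : ∀ e, a * edge K G e = 0
    · exact base n a v hv (mul_vertex_mem_pathSpan_of_mul_edge hN hall v)
    · push Not at hall
      obtain ⟨e, he⟩ := hall
      obtain ⟨x, hx⟩ := exists_mul_vertex_ne_zero he
      obtain ⟨u, l, u', l', w, h, h', k, hk, heq⟩ :=
        ih he (mul_edge_mem_boundedGrade hN e) x hx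
      have hu' : u' = G.tgt e := by
        by_contra hne
        rw [← edge_mul_tgt, mul_assoc, mul_assoc, mul_assoc,
          vertex_mul_pathAux_of_ne K h' (Ne.symm hne), mul_zero, mul_zero, mul_zero] at heq
        exact smul_ne_zero hk (vertex_ne_zero K G w) heq.symm
      subst hu'
      refine ⟨u, l, G.src e, e :: l', w, h, ⟨rfl, h'⟩, k, hk, ?_⟩
      rw [pathAux, ← heq]
      simp only [mul_assoc]

/-! ### Graded left ideals -/

/-- The left ideal generated by an element. -/
def leftIdeal (b : G.LeavittPathAlgebra K) : Submodule K (G.LeavittPathAlgebra K) :=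
  LinearMap.range (LinearMap.mulRight K b)

theorem mem_leftIdeal {a b : G.LeavittPathAlgebra K} : a ∈ leftIdeal b ↔ ∃ c, c * b = a := Iff.rfl

theorem self_mem_leftIdeal (b : G.LeavittPathAlgebra K) : b ∈ leftIdeal b :=
  exists_local_left_unit b

theorem leftIdeal_le {b : G.LeavittPathAlgebra K} {T : Submodule K (G.LeavittPathAlgebra K)}
    (hT : IsLeftIdeal T) (hb : b ∈ T) : leftIdeal b ≤ T := by
  rintro _ ⟨c, rfl⟩
  exact hT c b hb

/-- For `b` of degree `n`, `L b` is the sum of the `L_m b`, each of which lies in degree `m + n`. -/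
theorem isGradedLeftIdeal_leftIdeal {n : ℤ} {b : G.LeavittPathAlgebra K}
    (hb : b ∈ grade K G n) : IsGradedLeftIdeal (leftIdeal b) := by
  refine ⟨?_, le_antisymm ?_ (iSup_le fun n => inf_le_left)⟩
  · rintro a _ ⟨c, rfl⟩
    exact ⟨a * c, mul_assoc _ _ _⟩
  · rintro _ ⟨c, rfl⟩
    have hc : c ∈ ⨆ n, grade K G n := by rw [iSup_grade]; trivial
    induction hc using Submodule.iSup_induction' with
    | zero => rw [map_zero]; exact zero_mem _
    | add x y _ _ hx hy => rw [map_add]; exact add_mem hx hy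
    | mem m x hx => exact Submodule.mem_iSup_of_mem (m + n) ⟨⟨x, rfl⟩, mul_mem_grade hx hb⟩

theorem IsGradedLeftIdeal.exists_ne_zero {T : Submodule K (G.LeavittPathAlgebra K)}
    (hT : IsGradedLeftIdeal T) (h : T ≠ ⊥) : ∃ n, ∃ b ∈ T, b ∈ grade K G n ∧ b ≠ 0 := by
  by_contra! hall
  refine h (hT.2.trans (iSup_eq_bot.2 fun n => ?_))
  exact (Submodule.eq_bot_iff _).2 fun x hx => hall n x hx.1 hx.2

/-- The left ideal generated by a ghost path `β*` with `r(β)` straight is minimal. -/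
theorem isMinimalGradedLeftIdeal_ghostPathAux {u w : V} {l : List W} (h : G.IsPath u l w)
    (hw : G.IsStraight w) : IsMinimalGradedLeftIdeal (leftIdeal (ghostPathAux K G u l)) := by
  refine ⟨isGradedLeftIdeal_leftIdeal (ghostPathAux_mem_grade K h), ?_, ?_⟩
  · intro hbot
    have := self_mem_leftIdeal (ghostPathAux K G u l)
    rw [hbot, Submodule.mem_bot] at this
    exact ghostPathAux_ne_zero K h this
  · intro T hT hle
    refine or_iff_not_imp_left.2 fun hT0 => le_antisymm hle ?_
    obtain ⟨n, b, hbT, hbn, hb0⟩ := hT.exists_ne_zero hT0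
    obtain ⟨c, rfl⟩ := mem_leftIdeal.1 (hle hbT)
    have hb : c * ghostPathAux K G u l * pathAux K G u l = c * vertex K G w := by
      rw [mul_assoc, ghostPathAux_mul_pathAux_self K h]
    have hb2 : c * vertex K G w * ghostPathAux K G u l = c * ghostPathAux K G u l := by
      rw [mul_assoc, vertex_mul_ghostPathAux K h]
    -- The nonzero element `c β*` of `T` is traded for `c w`. It is homogeneous as `(c β*) β`, and
    -- nonzero because `(c w) β* = c β*`.
    have hcw : c * vertex K G w ∈ grade K G (n + l.length) := by
      rw [← hb]
      exact mul_mem_grade hbn (pathAux_mem_grade K h)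
    obtain ⟨u₁, l₁, u₂, l₂, v, h₁, h₂, k, hk, heq⟩ := exists_reduction hcw (by
      intro h0
      rw [← hb2, h0, zero_mul] at hb0
      exact hb0 rfl)
    have hu₂ : u₂ = w := by
      by_contra hne
      rw [mul_assoc, mul_assoc, vertex_mul_pathAux_of_ne K h₂ (Ne.symm hne), mul_zero,
        mul_zero] at heq
      exact smul_ne_zero hk (vertex_ne_zero K G v) heq.symm
    subst hu₂
    -- Write the reduction as `λ* (c w) μ = k v`. Since `w` is straight, `μ μ* = w`; multiplying by
    -- `μ` on the left and `μ*` on the right gives `μ λ* (c w) = k w`. So left multiplication alone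
    -- recovers `β*` from `c β*`.
    have key : pathAux K G u₂ l₂ * ghostPathAux K G u₁ l₁ * (c * vertex K G u₂) =
        k • vertex K G u₂ := by
      have := congrArg (fun x => pathAux K G u₂ l₂ * (x * ghostPathAux K G u₂ l₂)) heq
      simp only [smul_mul_assoc, mul_smul_comm, vertex_mul_ghostPathAux K h₂, mul_assoc,
        pathAux_mul_ghostPathAux_of_isStraight K h₂ hw, vertex_mul_self] at this
      simpa only [mul_assoc] using this
    refine leftIdeal_le hT.1 ?_
    have : ghostPathAux K G u l = k⁻¹ • (pathAux K G u₂ l₂ * ghostPathAux K G u₁ l₁ *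
        (c * ghostPathAux K G u l)) := by
      rw [← hb2, ← mul_assoc, key, smul_mul_assoc, vertex_mul_ghostPathAux K h, smul_smul,
        inv_mul_cancel₀ hk, one_smul]
    rw [this]
    exact Submodule.smul_mem _ _ (hT.1 _ _ hbT)

/-- Every minimal graded left ideal is generated by an element `w s` with `w` straight. -/
theorem IsMinimalGradedLeftIdeal.exists_eq_leftIdeal {S : Submodule K (G.LeavittPathAlgebra K)}
    (hS : IsMinimalGradedLeftIdeal S) :
    ∃ w s, G.IsStraight w ∧ vertex K G w * s = s ∧ S = leftIdeal s := by
  -- By minimality every nonzero homogeneous element of `S` generates it.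
  have hgen : ∀ {n : ℤ} {b : G.LeavittPathAlgebra K}, b ∈ S → b ∈ grade K G n → b ≠ 0 →
      leftIdeal b = S := by
    intro n b hb hbn hb0
    refine (hS.2.2 _ (isGradedLeftIdeal_leftIdeal hbn) (leftIdeal_le hS.1.1 hb)).resolve_left ?_
    intro hbot
    have := self_mem_leftIdeal b
    rw [hbot, Submodule.mem_bot] at this
    exact hb0 this
  obtain ⟨n, a, haS, han, ha0⟩ := hS.1.exists_ne_zero hS.2.1
  obtain ⟨u₁, l₁, u₂, l₂, w, h₁, h₂, k, hk, heq⟩ := exists_reduction han ha0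
  have hvw : k • vertex K G w ≠ 0 := smul_ne_zero hk (vertex_ne_zero K G w)
  generalize hs : ghostPathAux K G u₁ l₁ * a = s at heq
  have hsS : s ∈ S := hs ▸ hS.1.1 _ _ haS
  have hsn : s ∈ grade K G (-(l₁.length : ℤ) + n) :=
    hs ▸ mul_mem_grade (ghostPathAux_mem_grade K h₁) han
  have hs0 : s ≠ 0 := by
    rintro rfl
    exact hvw (heq ▸ zero_mul _)
  have hws : vertex K G w * s = s := by
    rw [← hs, ← mul_assoc, vertex_mul_ghostPathAux K h₁]
  refine ⟨w, s, ?_, hws, (hgen hsS hsn hs0).symm⟩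
  -- A bifurcation at the end of `μ` gives the paths `μ e` and `μ f`, neither a prefix of the other,
  -- so `(μ e)* (μ f) = 0`.
  rintro x ⟨μ, hμ⟩ ⟨e, f, hef, rfl, hf⟩
  have hp : G.IsPath w (μ ++ [e]) (G.tgt e) := hμ.append (isPath_singleton e)
  have hq : G.IsPath w (μ ++ [f]) (G.tgt f) := hμ.append ⟨hf, rfl⟩
  have hzero : ghostPathAux K G w (μ ++ [e]) * pathAux K G w (μ ++ [f]) = 0 := by
    rcases ghostPathAux_mul_pathAux K hp hq with ⟨σ, -, h, -⟩ | ⟨σ, -, h, -⟩ | h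
    · rw [List.append_assoc, List.append_cancel_left_eq] at h
      exact absurd (List.cons.inj h).1.symm hef
    · rw [List.append_assoc, List.append_cancel_left_eq] at h
      exact absurd (List.cons.inj h).1 hef
    · exact h
  generalize hp' : pathAux K G w (μ ++ [e]) = p at *
  generalize hp'' : ghostPathAux K G w (μ ++ [e]) = p' at *
  have hpp : p' * p = vertex K G (G.tgt e) := by
    rw [← hp', ← hp'', ghostPathAux_mul_pathAux_self K hp]
  have hpw : p' * vertex K G w = p' := by rw [← hp'', ghostPathAux_mul_vertex K hp]
  have hps0 : p' * s ≠ 0 := by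
    intro h0
    have : k • p' = 0 := by
      rw [← hpw, ← mul_smul_comm, ← heq, ← mul_assoc, h0, zero_mul]
    refine ghostPathAux_ne_zero K hp (?_ : ghostPathAux K G w (μ ++ [e]) = 0)
    rw [hp'']
    exact (smul_eq_zero.1 this).resolve_left hk
  have hpn : p' ∈ grade K G (-((μ ++ [e]).length : ℤ)) := hp'' ▸ ghostPathAux_mem_grade K hp
  -- `p' * s` generates `S` again, so `s = c p' s`. Multiplying on the right by the path that turns
  -- `s` into `k w` yields `c p' = w`, and then `w (μ f) = c p' (μ f) = 0`.
  have hmem : s ∈ leftIdeal (p' * s) := by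
    rw [hgen (hS.1.1 p' s hsS) (mul_mem_grade hpn hsn) hps0]
    exact hsS
  obtain ⟨c, hc⟩ := mem_leftIdeal.1 hmem
  have hcw : k • (c * p') = k • vertex K G w := by
    rw [← heq]
    conv_rhs => rw [← hc]
    rw [mul_assoc, mul_assoc, heq, mul_smul_comm, mul_smul_comm, hpw]
  have hcw' : c * p' = vertex K G w := smul_right_injective _ hk hcw
  refine pathAux_ne_zero K hq ?_
  rw [← vertex_mul_pathAux K hq, ← hcw', mul_assoc, hzero, mul_zero]

/-! ### The graded socle -/

variable (K G) in
/-- The span of the elements `α β*` such that `r(α) = r(β)` is straight. -/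
def straightIdeal : Submodule K (G.LeavittPathAlgebra K) :=
  Submodule.span K {x | ∃ u l u' l' w, G.IsPath u l w ∧ G.IsPath u' l' w ∧ G.IsStraight w ∧
    x = pathAux K G u l * ghostPathAux K G u' l'}

/-- A product of spanning elements either keeps the range `w` or replaces it by a vertex of `T(w)`,
which is again straight. -/
theorem mul_mem_straightIdeal (a : G.LeavittPathAlgebra K) {x : G.LeavittPathAlgebra K}
    (hx : x ∈ straightIdeal K G) : a * x ∈ straightIdeal K G := by
  induction hx using Submodule.span_induction with
  | zero => rw [mul_zero]; exact zero_mem _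
  | add x y _ _ hx hy => rw [mul_add]; exact add_mem hx hy
  | smul k x _ hx => rw [mul_smul_comm]; exact Submodule.smul_mem _ _ hx
  | mem x hx =>
    obtain ⟨u, l, u', l', w, h, h', hw, rfl⟩ := hx
    induction a using induction_on with
    | zero => rw [zero_mul]; exact zero_mem _
    | add x y hx hy => rw [add_mul]; exact add_mem hx hy
    | smul k x hx => rw [smul_mul_assoc]; exact Submodule.smul_mem _ _ hx
    | mem h₁ h₂ =>
      rw [mul_assoc, ← mul_assoc (ghostPathAux _ _ _ _)]
      rcases ghostPathAux_mul_pathAux K h₂ h with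
        ⟨σ, -, rfl, hσ, h₃⟩ | ⟨σ, -, rfl, hσ, h₃⟩ | h₃
      · rw [h₃, ← mul_assoc, ← pathAux_append K h₁ hσ]
        exact Submodule.subset_span ⟨_, _, _, _, w, h₁.append hσ, h', hw, rfl⟩
      · rw [h₃, ← ghostPathAux_append K h' hσ]
        exact Submodule.subset_span ⟨_, _, _, _, _, h₁, h'.append hσ,
          hw.of_mem_tree ⟨σ, hσ⟩, rfl⟩
      · rw [h₃, zero_mul, mul_zero]
        exact zero_mem _

theorem straightIdeal_mul_mem (a : G.LeavittPathAlgebra K) {x : G.LeavittPathAlgebra K}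
    (hx : x ∈ straightIdeal K G) : x * a ∈ straightIdeal K G := by
  induction hx using Submodule.span_induction with
  | zero => rw [zero_mul]; exact zero_mem _
  | add x y _ _ hx hy => rw [add_mul]; exact add_mem hx hy
  | smul k x _ hx => rw [smul_mul_assoc]; exact Submodule.smul_mem _ _ hx
  | mem x hx =>
    obtain ⟨u, l, u', l', w, h, h', hw, rfl⟩ := hx
    induction a using induction_on with
    | zero => rw [mul_zero]; exact zero_mem _
    | add x y hx hy => rw [mul_add]; exact add_mem hx hy
    | smul k x hx => rw [mul_smul_comm]; exact Submodule.smul_mem _ _ hx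
    | mem h₁ h₂ =>
      rw [mul_assoc, ← mul_assoc (ghostPathAux _ _ _ _)]
      rcases ghostPathAux_mul_pathAux K h' h₁ with
        ⟨σ, -, rfl, hσ, h₃⟩ | ⟨σ, -, rfl, hσ, h₃⟩ | h₃
      · rw [h₃, ← mul_assoc, ← pathAux_append K h hσ]
        exact Submodule.subset_span ⟨_, _, _, _, _, h.append hσ, h₂,
          hw.of_mem_tree ⟨σ, hσ⟩, rfl⟩
      · rw [h₃, ← ghostPathAux_append K h₂ hσ]
        exact Submodule.subset_span ⟨_, _, _, _, w, h, h₂.append hσ, hw, rfl⟩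
      · rw [h₃, zero_mul, mul_zero]
        exact zero_mem _

variable (K G)

theorem vertex_mem_straightIdeal {v : V} (hv : G.IsStraight v) :
    vertex K G v ∈ straightIdeal K G :=
  Submodule.subset_span ⟨v, [], v, [], v, rfl, rfl, hv, (vertex_mul_self K G v).symm⟩

/-- A minimal graded left ideal is `L s` with `s = w s` and `w` straight, so `s` lies in the ideal.
Conversely, `α β*` lies in the minimal left ideal `L β*`. -/
theorem mem_gradedSocle_iff {x : G.LeavittPathAlgebra K} :
    x ∈ gradedSocle K G ↔ x ∈ straightIdeal K G := by
  change x ∈ sSup {S : Submodule K (G.LeavittPathAlgebra K) | IsMinimalGradedLeftIdeal S} ↔ _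
  suffices H : sSup {S : Submodule K (G.LeavittPathAlgebra K) | IsMinimalGradedLeftIdeal S} =
      straightIdeal K G by rw [H]
  apply le_antisymm
  · refine sSup_le fun S hS => ?_
    obtain ⟨w, s, hw, hws, rfl⟩ := IsMinimalGradedLeftIdeal.exists_eq_leftIdeal hS
    refine leftIdeal_le (fun a x hx => mul_mem_straightIdeal a hx) ?_
    rw [← hws]
    exact straightIdeal_mul_mem s (vertex_mem_straightIdeal K G hw)
  · refine Submodule.span_le.2 ?_
    rintro _ ⟨u, l, u', l', w, h, h', hw, rfl⟩
    have hmin : leftIdeal (ghostPathAux K G u' l') ∈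
        {S : Submodule K (G.LeavittPathAlgebra K) | IsMinimalGradedLeftIdeal S} :=
      isMinimalGradedLeftIdeal_ghostPathAux h' hw
    exact le_sSup hmin (mem_leftIdeal.2 ⟨pathAux K G u l, rfl⟩)

theorem coe_straightIdeal_eq_span :
    (straightIdeal K G : Set (G.LeavittPathAlgebra K)) =
      (TwoSidedIdeal.span {x : G.LeavittPathAlgebra K |
          ∃ v : V, (G.IsLinePoint v ∨ G.IsLaurentVertex v) ∧ x = vertex K G v} :
        Set (G.LeavittPathAlgebra K)) := by
  apply Set.Subset.antisymm
  · intro x hx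
    change x ∈ straightIdeal K G at hx
    rw [SetLike.mem_coe]
    have hgen : ∀ {u u' w : V} {l l' : List W}, G.IsPath u l w → G.IsStraight w → ∀ k : K,
        k • (pathAux K G u l * ghostPathAux K G u' l') ∈ TwoSidedIdeal.span
          {x : G.LeavittPathAlgebra K |
            ∃ v : V, (G.IsLinePoint v ∨ G.IsLaurentVertex v) ∧ x = vertex K G v} := by
      intro u u' w l l' h hw k
      -- A two-sided ideal is not by definition closed under scalars, so `k` is absorbed into the
      -- left factor: `(k α) w β*`.
      rw [← pathAux_mul_vertex K h, ← smul_mul_assoc, ← smul_mul_assoc]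
      exact TwoSidedIdeal.mul_mem_right _ _ _ (TwoSidedIdeal.mul_mem_left _ _ _
        (TwoSidedIdeal.subset_span ⟨w, isStraight_iff.1 hw, rfl⟩))
    obtain ⟨n, c, g, rfl⟩ := Submodule.mem_span_set'.1 hx
    refine sum_mem fun i _ => ?_
    obtain ⟨u, l, u', l', w, h, -, hw, hg⟩ := (g i).2
    rw [hg]
    exact hgen h hw (c i)
  · have : TwoSidedIdeal.span {x : G.LeavittPathAlgebra K |
        ∃ v : V, (G.IsLinePoint v ∨ G.IsLaurentVertex v) ∧ x = vertex K G v} ≤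
        TwoSidedIdeal.mk' (straightIdeal K G : Set (G.LeavittPathAlgebra K)) (zero_mem _)
          (fun ha hb => add_mem ha hb) (fun ha => neg_mem ha)
          (fun {a _} hb => mul_mem_straightIdeal a hb)
          (fun {_ b} ha => straightIdeal_mul_mem b ha) := by
      rw [TwoSidedIdeal.span_le, TwoSidedIdeal.coe_mk']
      rintro _ ⟨v, hv, rfl⟩
      exact vertex_mem_straightIdeal K G (isStraight_iff.2 hv)
    intro x hx
    have := this hx
    rwa [TwoSidedIdeal.mem_mk'] at this

end DirGraph.LeavittPathAlgebra
end

noncomputable section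

/-! ### Systems of matrix units -/

namespace FinMatrix

variable {Λ A : Type*} [CommRing A]

/-- The matrix with the entry `a` in the position `(i, j)` and zeros elsewhere. -/
def single (i j : Λ) (a : A) : FinMatrix Λ A := Finsupp.single i (Finsupp.single j a)

open Classical in
theorem single_row (i j : Λ) (a : A) (k : Λ) :
    (single i j a) k = if i = k then Finsupp.single j a else 0 :=
  Finsupp.single_apply

theorem induction {P : FinMatrix Λ A → Prop} (M : FinMatrix Λ A) (zero : P 0)
    (add : ∀ M N, P M → P N → P (M + N)) (single : ∀ i j a, P (single i j a)) : P M := by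
  refine Finsupp.induction_linear (motive := P) M zero add fun i r => ?_
  refine Finsupp.induction_linear (motive := fun r => P (Finsupp.single i r)) r ?_ ?_ ?_
  · rw [Finsupp.single_zero]; exact zero
  · intro r s hr hs
    rw [Finsupp.single_add]; exact add _ _ hr hs
  · exact fun j a => single i j a

open Classical in
theorem single_mul_single (i j k l : Λ) (a b : A) :
    single i j a * single k l b = if j = k then single i l (a * b) else 0 := by
  apply ext_rows
  intro m
  rw [mul_row, single_row]
  by_cases hm : i = m
  · rw [if_pos hm, Finsupp.linearCombination_single, single_row]
    by_cases hj : j = k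
    · rw [if_pos hj.symm, if_pos hj, single_row, if_pos hm, Finsupp.smul_single, smul_eq_mul]
    · rw [if_neg (Ne.symm hj), if_neg hj, smul_zero]
      rfl
  · rw [if_neg hm, map_zero]
    by_cases hj : j = k
    · rw [if_pos hj, single_row, if_neg hm]
    · rw [if_neg hj]
      rfl

end FinMatrix

/-- A system of matrix units in a graded algebra `L`, with coefficients in a graded algebra `A`: the
products `x i * ev a * y j` multiply like matrices with a single entry. -/
structure MatrixSystem (K : Type*) [Field K] {L : Type*} [NonUnitalRing L] [Module K L]
    (𝒢 : ℤ → Submodule K L) {Λ A : Type*} [CommRing A] [Module K A] (𝒜 : ℤ → Submodule K A)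
    (δ : Λ → ℤ) where
  /-- the units of the first column -/
  x : Λ → L
  /-- the units of the first row -/
  y : Λ → L
  /-- the unit in the first position -/
  e : L
  /-- the coefficients, placed in the first position -/
  ev : A →ₗ[K] L
  y_mul_x_self : ∀ i, y i * x i = e
  y_mul_x_of_ne : ∀ i j, i ≠ j → y i * x j = 0
  ev_mul : ∀ a b, ev (a * b) = ev a * ev b
  e_mul_ev : ∀ a, e * ev a = ev a
  ev_mul_e : ∀ a, ev a * e = ev a
  ev_injective : Function.Injective ev
  x_mem : ∀ i, x i ∈ 𝒢 (δ i)
  y_mem : ∀ i, y i ∈ 𝒢 (-δ i)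
  -- One direction makes the map from matrices graded; the other lets degrees be read off from
  -- entries.
  ev_mem_iff : ∀ n a, ev a ∈ 𝒢 n ↔ a ∈ 𝒜 n

/-- An element of a direct sum of matrix rings is determined by its entries. -/
theorem MatrixSystem.ext_of_ev_eq {K : Type*} [Field K] {L : Type*} [NonUnitalRing L] [Module K L]
    {𝒢 : ℤ → Submodule K L} {ι : Type*} {Λ A : ι → Type*} [∀ i, CommRing (A i)]
    [∀ i, Module K (A i)] {𝒜 : ∀ i, ℤ → Submodule K (A i)} {δ : ∀ i, Λ i → ℤ}
    (S : ∀ i, MatrixSystem K 𝒢 (𝒜 i) (δ i)) {f g : algDirectSum K fun i => FinMatrix (Λ i) (A i)}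
    (h : ∀ i p q, (S i).ev (f.1 i p q) = (S i).ev (g.1 i p q)) : f = g :=
  Subtype.ext (funext fun i => FinMatrix.ext_rows fun p => Finsupp.ext fun q =>
    (S i).ev_injective (h i p q))

namespace MatrixSystem

variable {K : Type*} [Field K] {L : Type*} [NonUnitalRing L] [Module K L] [IsScalarTower K L L]
  [SMulCommClass K L L] {𝒢 : ℤ → Submodule K L}

section Single

variable {Λ A : Type*} [CommRing A] [Module K A] {𝒜 : ℤ → Submodule K A} {δ : Λ → ℤ}
  (S : MatrixSystem K 𝒢 𝒜 δ)

/-- The map from matrices to `L` defined by a system of matrix units, as a linear map. -/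
def linearHom : FinMatrix Λ A →ₗ[K] L :=
  Finsupp.lsum (M := Λ →₀ A) K fun i => Finsupp.lsum (M := A) K fun j =>
    LinearMap.mulLeft K (S.x i) ∘ₗ LinearMap.mulRight K (S.y j) ∘ₗ S.ev

theorem linearHom_apply (M : FinMatrix Λ A) :
    S.linearHom M = Finsupp.sum (M := Λ →₀ A) M fun i r => r.sum fun j a =>
      S.x i * (S.ev a * S.y j) := rfl

theorem linearHom_single (i j : Λ) (a : A) :
    S.linearHom (FinMatrix.single i j a) = S.x i * (S.ev a * S.y j) := by
  rw [linearHom_apply, FinMatrix.single, Finsupp.sum_single_index, Finsupp.sum_single_index]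
  · rw [map_zero, zero_mul, mul_zero]
  · exact Finsupp.sum_zero_index

/-- The map from matrices to `L` defined by a system of matrix units. -/
def hom : FinMatrix Λ A →ₙₐ[K] L :=
  { S.linearHom with
    map_zero' := map_zero S.linearHom
    map_mul' := fun M N => by
      change S.linearHom (M * N) = S.linearHom M * S.linearHom N
      induction M using FinMatrix.induction with
      | zero => rw [zero_mul, map_zero, zero_mul]
      | add M M' h h' => rw [add_mul, map_add, h, h', map_add, add_mul]
      | single i j a =>
        induction N using FinMatrix.induction with
        | zero => rw [mul_zero, map_zero, mul_zero]
        | add N N' h h' => rw [mul_add, map_add, h, h', map_add, mul_add]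
        | single k l b =>
          classical
          rw [FinMatrix.single_mul_single, linearHom_single, linearHom_single,
            show S.x i * (S.ev a * S.y j) * (S.x k * (S.ev b * S.y l)) =
              S.x i * (S.ev a * ((S.y j * S.x k) * (S.ev b * S.y l))) by simp only [mul_assoc]]
          split_ifs with h
          · subst h
            rw [linearHom_single, S.y_mul_x_self, ← mul_assoc S.e, S.e_mul_ev, S.ev_mul, mul_assoc]
          · rw [S.y_mul_x_of_ne _ _ h, zero_mul, mul_zero, mul_zero, map_zero] }

theorem hom_apply (M : FinMatrix Λ A) :
    S.hom M = Finsupp.sum (M := Λ →₀ A) M fun i r => r.sum fun j a =>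
      S.x i * (S.ev a * S.y j) := rfl

theorem hom_single (i j : Λ) (a : A) :
    S.hom (FinMatrix.single i j a) = S.x i * (S.ev a * S.y j) := S.linearHom_single i j a

theorem mul_hom_eq_zero {b : L} (h : ∀ i, b * S.x i = 0) (M : FinMatrix Λ A) :
    b * S.hom M = 0 := by
  induction M using FinMatrix.induction with
  | zero => rw [map_zero, mul_zero]
  | add M N hM hN => rw [map_add, mul_add, hM, hN, add_zero]
  | single i j a => rw [hom_single, ← mul_assoc, h, zero_mul]

theorem hom_mul_eq_zero {b : L} (h : ∀ i, S.y i * b = 0) (M : FinMatrix Λ A) :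
    S.hom M * b = 0 := by
  induction M using FinMatrix.induction with
  | zero => rw [map_zero, zero_mul]
  | add M N hM hN => rw [map_add, add_mul, hM, hN, add_zero]
  | single i j a => rw [hom_single, mul_assoc, mul_assoc, h, mul_zero, mul_zero]

/-- The entries of a matrix can be recovered from its image. -/
theorem y_mul_hom_mul_x (M : FinMatrix Λ A) (p q : Λ) :
    S.y p * S.hom M * S.x q = S.ev (M p q) := by
  classical
  induction M using FinMatrix.induction with
  | zero =>
    rw [map_zero, mul_zero, zero_mul]
    exact (map_zero S.ev).symm
  | add M N hM hN =>
    rw [map_add, mul_add, add_mul, hM, hN, FinMatrix.add_row, Finsupp.add_apply, map_add]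
  | single i j a =>
    rw [hom_single, FinMatrix.single_row,
      show S.y p * (S.x i * (S.ev a * S.y j)) * S.x q =
        (S.y p * S.x i) * (S.ev a * (S.y j * S.x q)) by simp only [mul_assoc]]
    by_cases hi : i = p
    · subst hi
      rw [if_pos rfl, S.y_mul_x_self, Finsupp.single_apply]
      by_cases hj : j = q
      · subst hj
        rw [if_pos rfl, S.y_mul_x_self, S.ev_mul_e, S.e_mul_ev]
      · rw [if_neg hj, S.y_mul_x_of_ne _ _ hj, mul_zero, mul_zero, map_zero]
    · rw [if_neg hi, S.y_mul_x_of_ne _ _ (Ne.symm hi), zero_mul, Finsupp.zero_apply, map_zero]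

theorem hom_mem (h𝒢 : ∀ {m n : ℤ} {a b : L}, a ∈ 𝒢 m → b ∈ 𝒢 n → a * b ∈ 𝒢 (m + n)) {n : ℤ}
    {M : FinMatrix Λ A} (hM : M ∈ FinMatrix.grade 𝒜 δ n) : S.hom M ∈ 𝒢 n := by
  rw [hom_apply]
  refine sum_mem fun i _ => sum_mem fun j _ => ?_
  have := h𝒢 (S.x_mem i) (h𝒢 ((S.ev_mem_iff _ _).2 (hM i j)) (S.y_mem j))
  rwa [show δ i + (n + δ j - δ i + -δ j) = n by ring] at this

end Single

/-! ### Orthogonal families of systems of matrix units -/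

variable {ι : Type*} {Λ A : ι → Type*} [∀ i, CommRing (A i)] [∀ i, Module K (A i)]
  {𝒜 : ∀ i, ℤ → Submodule K (A i)} {δ : ∀ i, Λ i → ℤ} (S : ∀ i, MatrixSystem K 𝒢 (𝒜 i) (δ i))

/-- `∑ᶠ` would be `0` on an infinite support; here the support is finite. The freedom in `s` allows
several elements to be summed over a common set. -/
theorem familyHom_eq_sum (f : algDirectSum K fun i => FinMatrix (Λ i) (A i)) {s : Finset ι}
    (hs : {i | f.1 i ≠ 0} ⊆ s) :
    ∑ᶠ i, (S i).hom (f.1 i) = ∑ i ∈ s, (S i).hom (f.1 i) := by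
  refine finsum_eq_sum_of_support_subset _ fun i hi => hs fun h => hi ?_
  change (S i).hom (f.1 i) = 0
  rw [h, map_zero]

theorem hom_mul_hom_of_ne (orth : ∀ i j, i ≠ j → ∀ p q, (S i).y p * (S j).x q = 0) {i j : ι}
    (h : i ≠ j) (M : FinMatrix (Λ i) (A i)) (N : FinMatrix (Λ j) (A j)) :
    (S i).hom M * (S j).hom N = 0 :=
  (S i).hom_mul_eq_zero (fun p => (S j).mul_hom_eq_zero (fun q => orth i j h p q) N) M

/-- The map from a direct sum of matrix rings to `L` defined by an orthogonal family of systems of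
matrix units. -/
def familyHom (orth : ∀ i j, i ≠ j → ∀ p q, (S i).y p * (S j).x q = 0) :
    algDirectSum K (fun i => FinMatrix (Λ i) (A i)) →ₙₐ[K] L where
  toFun f := ∑ᶠ i, (S i).hom (f.1 i)
  map_zero' := (finsum_congr fun i => map_zero (S i).hom).trans finsum_zero
  map_smul' k f := by
    have hf : {i | f.1 i ≠ 0}.Finite := f.2
    rw [familyHom_eq_sum S (k • f) (s := hf.toFinset), familyHom_eq_sum S f (s := hf.toFinset)]
    · rw [MonoidHom.id_apply, Finset.smul_sum]
      exact Finset.sum_congr rfl fun i _ => map_smul (S i).hom k (f.1 i)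
    · rw [Set.Finite.coe_toFinset]
    · rw [Set.Finite.coe_toFinset]
      intro i hi h
      exact hi (show k • f.1 i = 0 by rw [h, smul_zero])
  map_add' f g := by
    classical
    have hf : {i | f.1 i ≠ 0}.Finite := f.2
    have hg : {i | g.1 i ≠ 0}.Finite := g.2
    have hs : (↑(hf.toFinset ∪ hg.toFinset) : Set ι) = {i | f.1 i ≠ 0} ∪ {i | g.1 i ≠ 0} := by
      rw [Finset.coe_union, Set.Finite.coe_toFinset, Set.Finite.coe_toFinset]
    rw [familyHom_eq_sum S (f + g) (s := hf.toFinset ∪ hg.toFinset),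
      familyHom_eq_sum S f (s := hf.toFinset ∪ hg.toFinset),
      familyHom_eq_sum S g (s := hf.toFinset ∪ hg.toFinset), ← Finset.sum_add_distrib]
    · exact Finset.sum_congr rfl fun i _ => map_add (S i).hom (f.1 i) (g.1 i)
    · rw [hs]; exact Set.subset_union_right
    · rw [hs]; exact Set.subset_union_left
    · rw [hs]
      intro i hi
      by_contra h
      rw [Set.mem_union, not_or] at h
      have h1 : f.1 i = 0 := not_not.1 h.1
      have h2 : g.1 i = 0 := not_not.1 h.2
      exact hi (show f.1 i + g.1 i = 0 by rw [h1, h2, add_zero])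
  map_mul' f g := by
    have hf : {i | f.1 i ≠ 0}.Finite := f.2
    have hg : {i | g.1 i ≠ 0}.Finite := g.2
    rw [familyHom_eq_sum S (f * g) (s := hf.toFinset), familyHom_eq_sum S f (s := hf.toFinset),
      familyHom_eq_sum S g (s := hg.toFinset), Finset.sum_mul_sum]
    -- Orthogonality leaves only the diagonal of the double sum. If `g.1 i = 0`, the index `i` may
    -- be missing from the second set, but the diagonal term is then zero.
    · refine Finset.sum_congr rfl fun i _ => ?_
      rw [show (f * g).1 i = f.1 i * g.1 i from rfl, map_mul]
      by_cases hi : g.1 i = 0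
      · rw [hi, map_zero, mul_zero, Finset.sum_eq_zero]
        intro j _
        by_cases hij : i = j
        · subst hij
          rw [hi, map_zero, mul_zero]
        · exact hom_mul_hom_of_ne S orth hij _ _
      · rw [Finset.sum_eq_single i]
        · exact fun j _ hij => hom_mul_hom_of_ne S orth (Ne.symm hij) _ _
        · exact fun h => absurd (hg.mem_toFinset.2 hi) h
    · rw [Set.Finite.coe_toFinset]
    · rw [Set.Finite.coe_toFinset]
    · rw [Set.Finite.coe_toFinset]
      intro i hi h
      exact hi (show f.1 i * g.1 i = 0 by rw [h, zero_mul])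

variable (orth : ∀ i j, i ≠ j → ∀ p q, (S i).y p * (S j).x q = 0)

theorem familyHom_apply (f : algDirectSum K fun i => FinMatrix (Λ i) (A i)) :
    familyHom S orth f = ∑ᶠ i, (S i).hom (f.1 i) := rfl

theorem mul_familyHom_eq_zero {b : L} (h : ∀ i p, b * (S i).x p = 0)
    (f : algDirectSum K fun i => FinMatrix (Λ i) (A i)) : b * familyHom S orth f = 0 := by
  have hf : {i | f.1 i ≠ 0}.Finite := f.2
  rw [familyHom_apply, familyHom_eq_sum S f (s := hf.toFinset) (by rw [Set.Finite.coe_toFinset]),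
    Finset.mul_sum]
  exact Finset.sum_eq_zero fun i _ => (S i).mul_hom_eq_zero (h i) _

theorem familyHom_mul_eq_zero {b : L} (h : ∀ i p, (S i).y p * b = 0)
    (f : algDirectSum K fun i => FinMatrix (Λ i) (A i)) : familyHom S orth f * b = 0 := by
  have hf : {i | f.1 i ≠ 0}.Finite := f.2
  rw [familyHom_apply, familyHom_eq_sum S f (s := hf.toFinset) (by rw [Set.Finite.coe_toFinset]),
    Finset.sum_mul]
  exact Finset.sum_eq_zero fun i _ => (S i).hom_mul_eq_zero (h i) _

theorem y_mul_familyHom_mul_x (f : algDirectSum K fun i => FinMatrix (Λ i) (A i)) (i : ι)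
    (p q : Λ i) : (S i).y p * familyHom S orth f * (S i).x q = (S i).ev (f.1 i p q) := by
  classical
  have hf : {i | f.1 i ≠ 0}.Finite := f.2
  -- Inserting `i` keeps its term in the sum even if that component of `f` is zero.
  rw [familyHom_apply, familyHom_eq_sum S f (s := insert i hf.toFinset), Finset.mul_sum,
    Finset.sum_eq_single i, y_mul_hom_mul_x]
  · exact fun j _ hj => (S j).mul_hom_eq_zero (orth i j (Ne.symm hj) p) _
  · exact fun h => absurd (Finset.mem_insert_self _ _) h
  · rw [Finset.coe_insert, Set.Finite.coe_toFinset]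
    exact Set.subset_insert _ _

theorem familyHom_mem (h𝒢 : ∀ {m n : ℤ} {a b : L}, a ∈ 𝒢 m → b ∈ 𝒢 n → a * b ∈ 𝒢 (m + n)) {n : ℤ}
    {f : algDirectSum K fun i => FinMatrix (Λ i) (A i)}
    (hM : ∀ i, f.1 i ∈ FinMatrix.grade (𝒜 i) (δ i) n) : familyHom S orth f ∈ 𝒢 n := by
  have hf : {i | f.1 i ≠ 0}.Finite := f.2
  rw [familyHom_apply, familyHom_eq_sum S f (s := hf.toFinset) (by rw [Set.Finite.coe_toFinset])]
  exact sum_mem fun i _ => (S i).hom_mem h𝒢 (hM i)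

theorem familyHom_mem_of_x_mul_mem {I : Submodule K L} (h : ∀ i p b, (S i).x p * b ∈ I)
    (f : algDirectSum K fun i => FinMatrix (Λ i) (A i)) : familyHom S orth f ∈ I := by
  have hf : {i | f.1 i ≠ 0}.Finite := f.2
  rw [familyHom_apply, familyHom_eq_sum S f (s := hf.toFinset) (by rw [Set.Finite.coe_toFinset])]
  refine sum_mem fun i _ => ?_
  rw [hom_apply]
  exact sum_mem fun p _ => sum_mem fun q _ => h i p _

theorem exists_familyHom_eq (i : ι) (p q : Λ i) (a : A i) :
    ∃ f, familyHom S orth f = (S i).x p * ((S i).ev a * (S i).y q) := by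
  classical
  refine ⟨⟨Pi.single i (FinMatrix.single p q a), ?_⟩, ?_⟩
  · refine (Set.finite_singleton i).subset fun j hj => ?_
    by_contra hne
    exact hj (Pi.single_eq_of_ne hne _)
  · rw [familyHom_apply, finsum_eq_single _ i, ← hom_single]
    · exact congrArg _ (Pi.single_eq_same i _)
    · intro j hj
      exact (congrArg (S j).hom (Pi.single_eq_of_ne hj _)).trans (map_zero _)

end MatrixSystem
end

noncomputable section

/-! ### Laurent polynomials -/

/-- `a` is a unit of the corner ring with identity `e`, whose unit group supplies the integer
powers. -/
theorem exists_zpow {L : Type*} [NonUnitalRing L] {e a b : L} (he : e * e = e) (ea : e * a = a)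
    (ae : a * e = a) (eb : e * b = b) (be : b * e = b) (hab : a * b = e) (hba : b * a = e) :
    ∃ z : ℤ → L, z 0 = e ∧ (∀ m n, z (m + n) = z m * z n) ∧ z 1 = a ∧ z (-1) = b := by
  have idem : IsIdempotentElem e := he
  let u : idem.Cornerˣ :=
    { val := ⟨a, (Subsemigroup.mem_corner_iff idem).2 ⟨ea, ae⟩⟩
      inv := ⟨b, (Subsemigroup.mem_corner_iff idem).2 ⟨eb, be⟩⟩
      val_inv := Subtype.ext hab
      inv_val := Subtype.ext hba }
  refine ⟨fun n => ((u ^ n : idem.Cornerˣ) : idem.Corner).1, ?_, ?_, ?_, ?_⟩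
  · simp only [zpow_zero]; rfl
  · intro m n
    simp only [zpow_add]; rfl
  · simp only [zpow_one]; rfl
  · simp only [zpow_neg_one]; rfl

namespace LaurentPow

open LaurentPolynomial

variable (K : Type*) [Field K] (t : ℕ)

/-- The element `x ^ (t * j)` of `K[xᵗ, x⁻ᵗ]`. -/
def mono (j : ℤ) : LaurentPow K t :=
  ⟨T (t * j), by
    have h1 : (T (t : ℤ) : K[T;T⁻¹]) ∈ LaurentPow K t := Algebra.subset_adjoin (by simp)
    have h2 : (T (-(t : ℤ)) : K[T;T⁻¹]) ∈ LaurentPow K t := Algebra.subset_adjoin (by simp)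
    obtain ⟨n, rfl | rfl⟩ := j.eq_nat_or_neg
    · have := pow_mem h1 n
      rwa [T_pow, mul_comm] at this
    · have := pow_mem h2 n
      rwa [T_pow, show (n : ℤ) * -t = t * -n by ring] at this⟩

theorem coe_mono (j : ℤ) : (mono K t j : K[T;T⁻¹]) = T (t * j) := rfl

theorem mono_zero : mono K t 0 = 1 := Subtype.ext (by rw [coe_mono, mul_zero]; rfl)

theorem mono_add (i j : ℤ) : mono K t (i + j) = mono K t i * mono K t j :=
  Subtype.ext (by rw [coe_mono, mul_add, T_add]; rfl)

/-- The span is closed under products, because the monomials are, and it contains the two generators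
and the constants. -/
theorem span_range_mono : Submodule.span K (Set.range (mono K t)) = ⊤ := by
  refine eq_top_iff.2 fun a _ => ?_
  have key : ∀ x y : LaurentPow K t, x ∈ Submodule.span K (Set.range (mono K t)) →
      y ∈ Submodule.span K (Set.range (mono K t)) →
      x * y ∈ Submodule.span K (Set.range (mono K t)) := by
    intro x y hx hy
    have := Submodule.mul_mem_mul hx hy
    rw [Submodule.span_mul_span] at this
    refine Submodule.span_mono ?_ this
    rintro _ ⟨_, ⟨i, rfl⟩, _, ⟨j, rfl⟩, rfl⟩
    exact ⟨i + j, mono_add K t i j⟩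
  obtain ⟨a, ha⟩ := a
  induction ha using Algebra.adjoin_induction with
  | mem x hx =>
    rcases hx with rfl | rfl
    · exact Submodule.subset_span ⟨1, Subtype.ext (by rw [coe_mono, mul_one])⟩
    · exact Submodule.subset_span ⟨-1, Subtype.ext (by rw [coe_mono, mul_neg, mul_one])⟩
  | algebraMap k =>
    have : (⟨algebraMap K K[T;T⁻¹] k, Subalgebra.algebraMap_mem _ k⟩ : LaurentPow K t) =
        k • mono K t 0 := by
      rw [mono_zero, ← Algebra.algebraMap_eq_smul_one]; rfl
    exact this ▸ Submodule.smul_mem _ _ (Submodule.subset_span ⟨0, rfl⟩)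
  | add x y hx hy h h' => exact add_mem (h trivial) (h' trivial)
  | mul x y hx hy h h' => exact key ⟨x, hx⟩ ⟨y, hy⟩ (h trivial) (h' trivial)

/-- Linear maps on `K[xᵗ, x⁻ᵗ]` can be defined on the powers of `xᵗ`. -/
theorem exists_linearMap (ht : t ≠ 0) {L : Type*} [AddCommGroup L] [Module K L] (z : ℤ → L) :
    ∃ ev : LaurentPow K t →ₗ[K] L, ∀ j, ev (mono K t j) = z j := by
  -- The exponent `n = t * j` is sent to `z (n / t) = z j`; exponents not divisible by `t` do not
  -- occur.
  refine ⟨Finsupp.linearCombination K (fun n : ℤ => z (n / t)) ∘ₗ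
    (AddMonoidAlgebra.coeffLinearEquiv K).toLinearMap ∘ₗ
    (LaurentPow K t).val.toLinearMap, fun j => ?_⟩
  change Finsupp.linearCombination K _ (Finsupp.single ((t : ℤ) * j) (1 : K)) = _
  rw [Finsupp.linearCombination_single, one_smul,
    Int.mul_ediv_cancel_left _ (Int.natCast_ne_zero.2 ht)]

theorem mono_mem_laurentPowGrade (j : ℤ) : mono K t j ∈ laurentPowGrade K t (t * j) :=
  Submodule.mem_span_singleton_self _

variable {K t}

theorem eq_smul_of_mem_laurentPowGrade {n : ℤ} {a : LaurentPow K t}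
    (ha : a ∈ laurentPowGrade K t n) :
    a = 0 ∨ ∃ (j : ℤ) (k : K), n = t * j ∧ a = k • mono K t j := by
  obtain ⟨k, hk⟩ := Submodule.mem_span_singleton.1 (Submodule.mem_comap.1 ha)
  have hk : k • (T n : K[T;T⁻¹]) = a.1 := hk
  by_cases hn : ∃ j : ℤ, n = t * j
  · obtain ⟨j, rfl⟩ := hn
    exact Or.inr ⟨j, k, rfl, Subtype.ext hk.symm⟩
  · left
    -- The coefficient of `T n` vanishes on every `mono`, hence on the whole subalgebra, if `n` is
    -- not a multiple of `t`.
    let c : LaurentPow K t →ₗ[K] K := Finsupp.lapply n ∘ₗ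
      (AddMonoidAlgebra.coeffLinearEquiv K).toLinearMap ∘ₗ (LaurentPow K t).val.toLinearMap
    have hc : c = 0 := by
      refine LinearMap.ext_on (span_range_mono K t) ?_
      rintro _ ⟨j, rfl⟩
      exact Finsupp.single_eq_of_ne fun h => hn ⟨j, h⟩
    have hk0 : k = 0 := by
      have h : c a = 0 := by rw [hc]; rfl
      change (a.1 : K[T;T⁻¹]).coeff n = 0 at h
      rw [← hk] at h
      change k * (Finsupp.single n (1 : K)) n = 0 at h
      rwa [Finsupp.single_eq_same, mul_one] at h
    refine Subtype.ext ?_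
    rw [← hk, hk0, zero_smul]
    rfl

theorem induction {P : LaurentPow K t → Prop} (a : LaurentPow K t) (zero : P 0)
    (add : ∀ a b, P a → P b → P (a + b)) (smul : ∀ (k : K) (a), P a → P (k • a))
    (mono : ∀ j, P (mono K t j)) : P a := by
  have ha : a ∈ Submodule.span K (Set.range (LaurentPow.mono K t)) := by
    rw [span_range_mono]; trivial
  induction ha using Submodule.span_induction with
  | zero => exact zero
  | add x y _ _ hx hy => exact add x y hx hy
  | smul k x _ hx => exact smul k x hx
  | mem x hx => obtain ⟨j, rfl⟩ := hx; exact mono j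

end LaurentPow
end

noncomputable section

namespace DirGraph.LeavittPathAlgebra

variable {V W : Type*} (K : Type*) [Field K] {G : DirGraph V W}

/-! ### The matrix units of line points and of cycles without exits -/

theorem ghostPathAux_mul_pathAux_of_disjoint {u v u' v' : V} {l l' : List W}
    (h : G.IsPath u l v) (h' : G.IsPath u' l' v') (hd : ¬ (G.tree v ∩ G.tree v').Nonempty) :
    ghostPathAux K G u l * pathAux K G u' l' = 0 := by
  rcases ghostPathAux_mul_pathAux K h h' with ⟨σ, -, -, hσ, -⟩ | ⟨σ, -, -, hσ, -⟩ | h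
  · exact absurd ⟨v', ⟨σ, hσ⟩, mem_tree_self v'⟩ hd
  · exact absurd ⟨v, mem_tree_self v, ⟨σ, hσ⟩⟩ hd
  · exact h

/-- If `q` properly extended `p`, it would leave `r(p) ∈ T(v)` by one of its own edges, whereas it
meets `T(v)` only at its end. -/
theorem ghostPathAux_mul_pathAux_lineIndex {v : V} {p q : G.LineIndex v} (hpq : p ≠ q) :
    ghostPathAux K G p.1.start p.1.edges * pathAux K G q.1.start q.1.edges = 0 := by
  have key : ∀ {p q : G.LineIndex v} (σ : List W), p.1.start = q.1.start →
      q.1.edges = p.1.edges ++ σ → G.IsPath p.1.finish σ q.1.finish → p = q := by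
    intro p q σ hs he hσ
    by_cases hnil : σ = []
    · subst hnil
      exact Subtype.ext (Path.ext hs (by rw [he, List.append_nil]) hσ)
    · obtain ⟨e, heσ, hep⟩ := hσ.exists_src_eq hnil
      exact absurd (hep ▸ p.2.1) (q.2.2 e (by rw [he]; exact List.mem_append_right _ heσ))
  rcases ghostPathAux_mul_pathAux K p.1.isPath q.1.isPath with
    ⟨σ, hs, he, hσ, -⟩ | ⟨σ, hs, he, hσ, -⟩ | h
  · exact absurd (key σ hs he hσ) hpq
  · exact absurd (key σ hs.symm he hσ).symm hpq
  · exact h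

/-- If `q` extends `p`, the extra piece is closed at the base, hence a power of `c`; a positive
power would put all edges of `c` into `q`. -/
theorem ghostPathAux_mul_pathAux_cycleIndex {c : G.BasedCycleWithoutExits} {p q : CycleIndex c}
    (hpq : p ≠ q) :
    ghostPathAux K G p.1.start p.1.edges * pathAux K G q.1.start q.1.edges = 0 := by
  have key : ∀ {p q : CycleIndex c} (σ : List W), p.1.start = q.1.start →
      q.1.edges = p.1.edges ++ σ → G.IsPath p.1.finish σ q.1.finish → p = q := by
    intro p q σ hs he hσ
    rw [p.2.1, q.2.1] at hσ
    obtain ⟨k, rfl⟩ := c.2.isStraight.eq_flatten_replicate c.2.1 hσ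
    cases k with
    | zero =>
      exact Subtype.ext (Path.ext hs (by simpa using he.symm) (p.2.1.trans q.2.1.symm))
    | succ k =>
      refine absurd (fun e hec => ?_) q.2.2
      rw [he, List.replicate_succ, List.flatten_cons]
      exact List.mem_append_right _ (List.mem_append_left _ hec)
  rcases ghostPathAux_mul_pathAux K p.1.isPath q.1.isPath with
    ⟨σ, hs, he, hσ, -⟩ | ⟨σ, hs, he, hσ, -⟩ | h
  · exact absurd (key σ hs he hσ) hpq
  · exact absurd (key σ hs.symm he hσ).symm hpq
  · exact h

/-- The matrix units of a line point. -/
theorem exists_lineSystem {v : V} (hv : G.IsLinePoint v) :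
    ∃ S : MatrixSystem K (grade K G) (fieldGrade K) (G.lineShift v),
      (∀ k, S.ev k = k • vertex K G v) ∧
      ∀ p : G.LineIndex v, ∃ τ, G.IsPath v τ p.1.finish ∧
        S.x p = pathAux K G p.1.start p.1.edges * ghostPathAux K G v τ ∧
        S.y p = pathAux K G v τ * ghostPathAux K G p.1.start p.1.edges := by
  -- The unit of `p` is `p τ*`, with `τ` the path from `v` to `r(p)`. It brings every index back to
  -- the single vertex `v` and accounts for the shift `|p| - d(v, r(p))`.
  choose τ hτ using fun p : G.LineIndex v => p.2.1
  obtain ⟨ε, hε, hε0⟩ := exists_linear_form K G v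
  refine ⟨{
    x := fun p => pathAux K G p.1.start p.1.edges * ghostPathAux K G v (τ p)
    y := fun p => pathAux K G v (τ p) * ghostPathAux K G p.1.start p.1.edges
    e := vertex K G v
    ev := LinearMap.toSpanSingleton K _ (vertex K G v)
    y_mul_x_self := fun p => ?_
    y_mul_x_of_ne := fun p q hpq => ?_
    ev_mul := fun a b => ?_
    e_mul_ev := fun a => ?_
    ev_mul_e := fun a => ?_
    ev_injective := ?_
    x_mem := fun p => ?_
    y_mem := fun p => ?_
    ev_mem_iff := fun n a => ?_ }, fun k => rfl, fun p => ⟨τ p, hτ p, rfl, rfl⟩⟩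
  · rw [mul_assoc, ← mul_assoc (ghostPathAux _ _ _ _), ghostPathAux_mul_pathAux_self K p.1.isPath,
      vertex_mul_ghostPathAux K (hτ p),
      pathAux_mul_ghostPathAux_of_isStraight K (hτ p) hv.isStraight]
  · rw [mul_assoc, ← mul_assoc (ghostPathAux _ _ _ _), ghostPathAux_mul_pathAux_lineIndex K hpq,
      zero_mul, mul_zero]
  · simp only [LinearMap.toSpanSingleton_apply, smul_mul_smul_comm, vertex_mul_self]
  · simp only [LinearMap.toSpanSingleton_apply, mul_smul_comm, vertex_mul_self]
  · simp only [LinearMap.toSpanSingleton_apply, smul_mul_assoc, vertex_mul_self]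
  · exact smul_left_injective K (vertex_ne_zero K G v)
  · refine pathAux_mul_ghostPathAux_mem_grade K p.1.isPath (hτ p) ?_
    rw [lineShift, hv.dist_eq (hτ p), Path.length]
  · refine pathAux_mul_ghostPathAux_mem_grade K (hτ p) p.1.isPath ?_
    rw [lineShift, hv.dist_eq (hτ p), Path.length, neg_sub]
  · rw [LinearMap.toSpanSingleton_apply, fieldGrade]
    split_ifs with hn
    · subst hn
      exact ⟨fun _ => trivial, fun _ => Submodule.smul_mem _ _ (vertex_mem_grade K v)⟩
    · rw [Submodule.mem_bot]
      constructor
      · intro h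
        have := hε0 n hn _ h
        rwa [map_smul, hε, smul_eq_mul, mul_one] at this
      · rintro rfl
        rw [zero_smul]
        exact zero_mem _

/-- The matrix units of a cycle without exits. -/
theorem exists_cycleSystem (c : G.BasedCycleWithoutExits) :
    ∃ S : MatrixSystem K (grade K G) (laurentPowGrade K c.length) (cycleShift c),
      (∀ i j : ℕ, S.ev (LaurentPow.mono K c.length (i - j)) =
        pathAux K G c.base (List.replicate i c.edges).flatten *
          ghostPathAux K G c.base (List.replicate j c.edges).flatten) ∧
      (∀ p : CycleIndex c, S.x p = pathAux K G p.1.start p.1.edges) ∧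
      ∀ p : CycleIndex c, S.y p = ghostPathAux K G p.1.start p.1.edges := by
  have hc : G.IsPath c.base c.edges c.base := c.2.1.2.1
  have ht : c.length ≠ 0 := fun h => c.2.1.1 (List.eq_nil_of_length_eq_zero h)
  obtain ⟨ε, hε, hε0⟩ := exists_linear_form K G c.base
  -- As `c` has no exit, `c c* = c* c` is the base vertex, so `c` has integer powers `z`.
  obtain ⟨z, z0, zadd, z1, z1'⟩ := exists_zpow (vertex_mul_self K G c.base)
    (vertex_mul_pathAux K hc) (pathAux_mul_vertex K hc) (vertex_mul_ghostPathAux K hc)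
    (ghostPathAux_mul_vertex K hc) (pathAux_mul_ghostPathAux_of_isStraight K hc c.2.isStraight)
    (ghostPathAux_mul_pathAux_self K hc)
  have zpos : ∀ i : ℕ, z i = pathAux K G c.base (List.replicate i c.edges).flatten := by
    intro i
    induction i with
    | zero => exact z0
    | succ i ih =>
      rw [List.replicate_succ, List.flatten_cons, pathAux_append K hc (hc.flatten_replicate i),
        ← ih, ← z1, ← zadd, Nat.cast_succ, add_comm]
  have zneg : ∀ i : ℕ, z (-i) = ghostPathAux K G c.base (List.replicate i c.edges).flatten := by
    intro i
    induction i with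
    | zero => exact z0
    | succ i ih =>
      rw [List.replicate_succ, List.flatten_cons,
        ghostPathAux_append K hc (hc.flatten_replicate i), ← ih, ← z1', ← zadd, Nat.cast_succ,
        neg_add]
  have zmem : ∀ j, z j ∈ grade K G (c.length * j) := by
    intro j
    obtain ⟨n, rfl | rfl⟩ := j.eq_nat_or_neg
    · have := pathAux_mem_grade K (hc.flatten_replicate n)
      rw [← zpos] at this
      simpa [BasedCycleWithoutExits.length, mul_comm] using this
    · have := ghostPathAux_mem_grade K (hc.flatten_replicate n)
      rw [← zneg] at this
      simpa [BasedCycleWithoutExits.length, mul_comm] using this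
  obtain ⟨ev, hev⟩ := LaurentPow.exists_linearMap K c.length ht z
  have hspan : ∀ a : LaurentPow K c.length, ∃ f : ℤ →₀ K,
      (f.sum fun i k => k • LaurentPow.mono K c.length i) = a := by
    intro a
    refine Finsupp.mem_span_range_iff_exists_finsupp.1 ?_
    rw [LaurentPow.span_range_mono]
    trivial
  have hcoeff : ∀ (f : ℤ →₀ K) (m : ℤ),
      ev (f.sum fun i k => k • LaurentPow.mono K c.length i) ∈ grade K G m →
        ∀ i, (c.length : ℤ) * i ≠ m → f i = 0 := by
    intro f m hm i hi
    -- Multiplying by `z (-i)` moves the term of index `i` to degree `0`, where `ε` reads `f i`. The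
    -- product also has degree `m - |c| i ≠ 0`, so `ε` vanishes on it.
    have h := hε0 (c.length * (-i) + m) (by rw [mul_neg]; omega) _ (mul_mem_grade (zmem (-i)) hm)
    rw [map_finsuppSum, Finsupp.mul_sum, map_finsuppSum, Finsupp.sum, Finset.sum_eq_single i] at h
    · rwa [map_smul, hev, mul_smul_comm, ← zadd, neg_add_cancel, z0, map_smul, hε, smul_eq_mul,
        mul_one] at h
    · intro j _ hj
      rw [map_smul, hev, mul_smul_comm, ← zadd, map_smul, hε0 _ _ _ (zmem _), smul_zero]
      rw [mul_ne_zero_iff]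
      exact ⟨Int.natCast_ne_zero.2 ht, by omega⟩
    · intro hi
      rw [Finsupp.notMem_support_iff.1 hi, zero_smul, map_zero, mul_zero, map_zero]
  refine ⟨{
    x := fun p => pathAux K G p.1.start p.1.edges
    y := fun p => ghostPathAux K G p.1.start p.1.edges
    e := vertex K G c.base
    ev := ev
    y_mul_x_self := fun p => ?_
    y_mul_x_of_ne := fun p q hpq => ghostPathAux_mul_pathAux_cycleIndex K hpq
    ev_mul := fun a b => ?_
    e_mul_ev := fun a => ?_
    ev_mul_e := fun a => ?_
    ev_injective := ?_
    x_mem := fun p => pathAux_mem_grade K p.1.isPath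
    y_mem := fun p => ghostPathAux_mem_grade K p.1.isPath
    ev_mem_iff := fun n a => ⟨fun h => ?_, fun h => ?_⟩ },
      fun i j => ?_, fun p => rfl, fun p => rfl⟩
  · rw [ghostPathAux_mul_pathAux_self K p.1.isPath, p.2.1]
  · induction a using LaurentPow.induction with
    | zero => rw [zero_mul, map_zero, zero_mul]
    | add a a' h h' => rw [add_mul, map_add, h, h', map_add, add_mul]
    | smul k a h => rw [smul_mul_assoc, map_smul, h, map_smul, smul_mul_assoc]
    | mono i =>
      induction b using LaurentPow.induction with
      | zero => rw [mul_zero, map_zero, mul_zero]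
      | add a a' h h' => rw [mul_add, map_add, h, h', map_add, mul_add]
      | smul k a h => rw [mul_smul_comm, map_smul, h, map_smul, mul_smul_comm]
      | mono j => rw [← LaurentPow.mono_add, hev, hev, hev, zadd]
  · induction a using LaurentPow.induction with
    | zero => rw [map_zero, mul_zero]
    | add a a' h h' => rw [map_add, mul_add, h, h']
    | smul k a h => rw [map_smul, mul_smul_comm, h]
    | mono j => rw [hev, ← z0, ← zadd, zero_add]
  · induction a using LaurentPow.induction with
    | zero => rw [map_zero, zero_mul]
    | add a a' h h' => rw [map_add, add_mul, h, h']
    | smul k a h => rw [map_smul, smul_mul_assoc, h]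
    | mono j => rw [hev, ← z0, ← zadd, add_zero]
  · refine (injective_iff_map_eq_zero ev).2 fun a ha => ?_
    obtain ⟨f, rfl⟩ := hspan a
    -- Zero lies in every component; the degree `|c| i + 1` is one that differs from `|c| i`.
    have hf : f = 0 := Finsupp.ext fun i =>
      hcoeff f (c.length * i + 1) (by rw [ha]; exact zero_mem _) i (by omega)
    rw [hf, Finsupp.sum_zero_index]
  · obtain ⟨f, rfl⟩ := hspan a
    refine sum_mem fun i hi => Submodule.smul_mem _ _ ?_
    obtain rfl : (c.length : ℤ) * i = n := by
      by_contra hne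
      exact Finsupp.mem_support_iff.1 hi (hcoeff f n h i hne)
    exact LaurentPow.mono_mem_laurentPowGrade K c.length i
  · rcases LaurentPow.eq_smul_of_mem_laurentPowGrade h with rfl | ⟨j, k, rfl, rfl⟩
    · rw [map_zero]
      exact zero_mem _
    · rw [map_smul, hev]
      exact Submodule.smul_mem _ _ (zmem j)
  · rw [hev, sub_eq_add_neg, zadd, zpos, zneg]

/-! ### The span of the matrix units -/

/-- Inserts `w = μ μ*`, so that the common range can be moved to a chosen line or cycle. -/
theorem pathAux_mul_ghostPathAux_eq_append {u u' w x : V} {l l' μ : List W} (h : G.IsPath u l w)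
    (h' : G.IsPath u' l' w) (hw : G.IsStraight w) (hμ : G.IsPath w μ x) :
    pathAux K G u l * ghostPathAux K G u' l' =
      pathAux K G u (l ++ μ) * ghostPathAux K G u' (l' ++ μ) := by
  rw [pathAux_append K h hμ, ghostPathAux_append K h' hμ, mul_assoc,
    ← mul_assoc (pathAux K G w μ), pathAux_mul_ghostPathAux_of_isStraight K hμ hw,
    vertex_mul_ghostPathAux K h']

theorem eq_x_mul_ev_mul_y_of_mem_tree {v : V} (hv : G.IsLinePoint v)
    {S : MatrixSystem K (grade K G) (fieldGrade K) (G.lineShift v)}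
    (hev : ∀ k, S.ev k = k • vertex K G v)
    (hS : ∀ p : G.LineIndex v, ∃ τ, G.IsPath v τ p.1.finish ∧
      S.x p = pathAux K G p.1.start p.1.edges * ghostPathAux K G v τ ∧
      S.y p = pathAux K G v τ * ghostPathAux K G p.1.start p.1.edges)
    {u u' w : V} {l l' : List W} (h : G.IsPath u l w) (h' : G.IsPath u' l' w)
    (hw : w ∈ G.tree v) :
    ∃ p q, pathAux K G u l * ghostPathAux K G u' l' = S.x p * (S.ev 1 * S.y q) := by
  obtain ⟨p, σ, a, rfl, hp, hσ, ha, hpa⟩ := h.exists_first_entry _ hw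
  obtain ⟨q, ρ, b, rfl, hq, hρ, hb, hqb⟩ := h'.exists_first_entry _ hw
  let p' : G.LineIndex v := ⟨⟨u, p, a, hp⟩, ha, hpa⟩
  let q' : G.LineIndex v := ⟨⟨u', q, b, hq⟩, hb, hqb⟩
  obtain ⟨τ, hτ, hx, -⟩ := hS p'
  obtain ⟨τ', hτ', -, hy⟩ := hS q'
  have hτ : G.IsPath v τ a := hτ
  have hτ' : G.IsPath v τ' b := hτ'
  -- Both are paths from the line point `v` to `w`. Their equality turns `τ* τ'` into `σ ρ*`, the
  -- part of `α β*` that runs along the line.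
  have heq : τ ++ σ = τ' ++ ρ := hv.path_unique (hτ.append hσ) (hτ'.append hρ)
  have hmid : ghostPathAux K G v τ * pathAux K G v τ' =
      pathAux K G a σ * ghostPathAux K G b ρ := by
    have h1 : pathAux K G v τ' = pathAux K G v (τ' ++ ρ) * ghostPathAux K G b ρ := by
      rw [pathAux_append K hτ' hρ, mul_assoc, pathAux_mul_ghostPathAux_of_isStraight K hρ
        (hv.isStraight.of_mem_tree hb), pathAux_mul_vertex K hτ']
    rw [h1, ← heq, pathAux_append K hτ hσ, ← mul_assoc, ← mul_assoc,
      ghostPathAux_mul_pathAux_self K hτ, vertex_mul_pathAux K hσ]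
  refine ⟨p', q', ?_⟩
  rw [hx, hy, hev, one_smul, ← mul_assoc (vertex K G v), vertex_mul_pathAux K hτ',
    pathAux_append K hp hσ, ghostPathAux_append K hq hρ]
  calc _ = pathAux K G u p * (pathAux K G a σ * ghostPathAux K G b ρ) *
        ghostPathAux K G u' q := by simp only [mul_assoc]
    _ = pathAux K G u p * (ghostPathAux K G v τ * pathAux K G v τ') *
        ghostPathAux K G u' q := by rw [hmid]
    _ = _ := by simp only [mul_assoc]; rfl

theorem eq_x_mul_ev_mul_y_of_cycle {c : G.BasedCycleWithoutExits}
    {S : MatrixSystem K (grade K G) (laurentPowGrade K c.length) (cycleShift c)}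
    (hev : ∀ i j : ℕ, S.ev (LaurentPow.mono K c.length (i - j)) =
      pathAux K G c.base (List.replicate i c.edges).flatten *
        ghostPathAux K G c.base (List.replicate j c.edges).flatten)
    (hx : ∀ p : CycleIndex c, S.x p = pathAux K G p.1.start p.1.edges)
    (hy : ∀ p : CycleIndex c, S.y p = ghostPathAux K G p.1.start p.1.edges)
    {u u' : V} {l l' : List W} (h : G.IsPath u l c.base) (h' : G.IsPath u' l' c.base) :
    ∃ p a q, pathAux K G u l * ghostPathAux K G u' l' = S.x p * (S.ev a * S.y q) := by
  -- With `α = p c^i` and `β = q c^j`, the product is `p c^(i-j) q*`, so the coefficient is the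
  -- monomial of index `i - j`.
  obtain ⟨p, i, rfl, hp, hpc⟩ := c.2.exists_eq_append h
  obtain ⟨q, j, rfl, hq, hqc⟩ := c.2.exists_eq_append h'
  have hc : G.IsPath c.base c.edges c.base := c.2.1.2.1
  have hp : G.IsPath u p c.base := hp
  have hq : G.IsPath u' q c.base := hq
  let p' : CycleIndex c := ⟨⟨u, p, c.base, hp⟩, rfl, hpc⟩
  let q' : CycleIndex c := ⟨⟨u', q, c.base, hq⟩, rfl, hqc⟩
  have hp' : S.x p' = pathAux K G u p := hx p'
  have hq' : S.y q' = ghostPathAux K G u' q := hy q'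
  refine ⟨p', LaurentPow.mono K c.length (i - j), q', ?_⟩
  rw [hp', hq', hev]
  refine (congrArg₂ (· * ·) (pathAux_append K hp (hc.flatten_replicate i))
    (ghostPathAux_append K hq (hc.flatten_replicate j))).trans ?_
  simp only [mul_assoc]

end DirGraph.LeavittPathAlgebra
end

noncomputable section

/-! ### Homomorphisms of not necessarily unital algebras -/

namespace NonUnitalAlgHom

variable {K R R' L : Type*} [Field K] [NonUnitalNonAssocSemiring R] [DistribMulAction K R]
  [NonUnitalNonAssocSemiring R'] [DistribMulAction K R'] [NonUnitalRing L] [Module K L]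

/-- Two homomorphisms with orthogonal ranges define a homomorphism on the product. -/
def coprodOfOrthogonal (f : R →ₙₐ[K] L) (g : R' →ₙₐ[K] L) (hfg : ∀ a b, f a * g b = 0)
    (hgf : ∀ a b, g b * f a = 0) : R × R' →ₙₐ[K] L where
  toFun a := f a.1 + g a.2
  map_zero' := by rw [Prod.fst_zero, Prod.snd_zero, map_zero, map_zero, add_zero]
  map_add' a b := by rw [Prod.fst_add, Prod.snd_add, map_add, map_add, add_add_add_comm]
  map_smul' k a := by
    rw [Prod.smul_fst, Prod.smul_snd, map_smul, map_smul, smul_add, MonoidHom.id_apply]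
  map_mul' a b := by
    rw [Prod.fst_mul, Prod.snd_mul, map_mul, map_mul, add_mul, mul_add, mul_add, hfg, hgf,
      add_zero, zero_add]

/-- An injective homomorphism has an inverse on its range. -/
theorem exists_inverse_of_injective {f : R →ₙₐ[K] L} (hf : Function.Injective f)
    {S : NonUnitalSubalgebra K L} (hS : ∀ x, x ∈ S ↔ ∃ a, f a = x) :
    ∃ g : S →ₙₐ[K] R, Function.Bijective g ∧ ∀ x, f (g x) = x := by
  choose g hg using fun x : S => (hS x).1 x.2
  refine ⟨{
    toFun := g
    map_zero' := hf (by rw [hg, map_zero]; rfl)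
    map_add' := fun x y => hf (by rw [map_add, hg, hg, hg]; rfl)
    map_smul' := fun k x => hf (by rw [hg, MonoidHom.id_apply, map_smul, hg]; rfl)
    map_mul' := fun x y => hf (by rw [map_mul, hg, hg, hg]; rfl) }, ⟨?_, ?_⟩, hg⟩
  · intro x y hxy
    have hxy : g x = g y := hxy
    exact Subtype.ext (by rw [← hg, ← hg, hxy])
  · exact fun a => ⟨⟨f a, (hS _).2 ⟨a, rfl⟩⟩, hf (hg _)⟩

end NonUnitalAlgHom

namespace DirGraph.LeavittPathAlgebra

variable {V W : Type*} (K : Type*) [Field K] {G : DirGraph V W}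

/-! ### The structure of the graded socle -/

/-- The graded embedding of the direct sum of matrix rings in the Leavitt path algebra. -/
theorem exists_socleModel_embedding {X : Set V} {Y : Set G.BasedCycleWithoutExits}
    (hX : G.IsLinePointTransversal X) (hY : G.IsCycleTransversal Y) :
    ∃ ψ : G.SocleModel K X Y →ₙₐ[K] G.LeavittPathAlgebra K, Function.Injective ψ ∧
      (∀ x, x ∈ straightIdeal K G ↔ ∃ f, ψ f = x) ∧
      ∀ n f, ψ f ∈ grade K G n ↔ f ∈ G.socleModelGrade K X Y n := by
  choose S hSev hS using fun v : X => exists_lineSystem K (hX.1 v v.2)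
  choose S' hSev' hSx' hSy' using fun c : Y => exists_cycleSystem K c.1
  have treeX : ∀ v w : X, v ≠ w → ¬ (G.tree v.1 ∩ G.tree w.1).Nonempty := by
    intro v w hvw hne
    refine hvw (Subtype.ext ((hX.2 v.1 (hX.1 v v.2)).unique ⟨v.2, ?_⟩ ⟨w.2, hne⟩))
    exact ⟨v.1, mem_tree_self _, mem_tree_self _⟩
  have treeY : ∀ c d : Y, c ≠ d → ¬ (G.tree c.1.base ∩ G.tree d.1.base).Nonempty := by
    rintro c d hcd ⟨w, hw, hw'⟩
    exact hcd (Subtype.ext ((hY d.1).unique ⟨c.2, c.1.2.isRotated d.1.2 hw hw'⟩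
      ⟨d.2, List.IsRotated.refl _⟩))
  have treeXY : ∀ (v : X) (c : Y), ¬ (G.tree v.1 ∩ G.tree c.1.base).Nonempty := fun v c =>
    (hX.1 v v.2).disjoint_tree_cycle c.1.2
  have orthX : ∀ v w : X, v ≠ w → ∀ p q, (S v).y p * (S w).x q = 0 := by
    intro v w hvw p q
    obtain ⟨τ, hτ, -, hy⟩ := hS v p
    obtain ⟨ρ, hρ, hx, -⟩ := hS w q
    rw [hx, hy, mul_assoc, ← mul_assoc (ghostPathAux _ _ _ _),
      ghostPathAux_mul_pathAux_of_disjoint K p.1.isPath q.1.isPath, zero_mul, mul_zero]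
    exact fun h => treeX v w hvw
      (h.mono (Set.inter_subset_inter (tree_subset p.2.1) (tree_subset q.2.1)))
  have orthY : ∀ c d : Y, c ≠ d → ∀ p q, (S' c).y p * (S' d).x q = 0 := by
    intro c d hcd p q
    rw [hSx', hSy', ghostPathAux_mul_pathAux_of_disjoint K p.1.isPath q.1.isPath]
    rw [p.2.1, q.2.1]
    exact treeY c d hcd
  have orthXY : ∀ (v : X) (c : Y) p q, (S v).y p * (S' c).x q = 0 := by
    intro v c p q
    obtain ⟨τ, hτ, -, hy⟩ := hS v p
    rw [hSx', hy, mul_assoc, ghostPathAux_mul_pathAux_of_disjoint K p.1.isPath q.1.isPath,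
      mul_zero]
    rw [q.2.1]
    exact fun h => treeXY v c (h.mono (Set.inter_subset_inter_left _ (tree_subset p.2.1)))
  have orthYX : ∀ (c : Y) (v : X) p q, (S' c).y p * (S v).x q = 0 := by
    intro c v p q
    obtain ⟨τ, hτ, hx, -⟩ := hS v q
    rw [hSy', hx, ← mul_assoc, ghostPathAux_mul_pathAux_of_disjoint K p.1.isPath q.1.isPath,
      zero_mul]
    rw [p.2.1, Set.inter_comm]
    exact fun h => treeXY v c (h.mono (Set.inter_subset_inter_left _ (tree_subset q.2.1)))
  let ψ₁ := MatrixSystem.familyHom S orthX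
  let ψ₂ := MatrixSystem.familyHom S' orthY
  have h12 : ∀ f g, ψ₁ f * ψ₂ g = 0 := fun f g =>
    MatrixSystem.familyHom_mul_eq_zero S orthX
      (fun v p => MatrixSystem.mul_familyHom_eq_zero S' orthY (fun c q => orthXY v c p q) g) f
  have h21 : ∀ f g, ψ₂ g * ψ₁ f = 0 := fun f g =>
    MatrixSystem.familyHom_mul_eq_zero S' orthY
      (fun c p => MatrixSystem.mul_familyHom_eq_zero S orthX (fun v q => orthYX c v p q) f) g
  let ψ : G.SocleModel K X Y →ₙₐ[K] G.LeavittPathAlgebra K := ψ₁.coprodOfOrthogonal ψ₂ h12 h21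
  have hψ : ∀ f, ψ f = ψ₁ f.1 + ψ₂ f.2 := fun _ => rfl
  -- The other blocks vanish between `y p` and `x q`, so each entry is visible inside `L`.
  have entry₁ : ∀ f (v : X) p q, (S v).y p * ψ f * (S v).x q = (S v).ev (f.1.1 v p q) := by
    intro f v p q
    rw [hψ, mul_add, add_mul, MatrixSystem.y_mul_familyHom_mul_x,
      MatrixSystem.mul_familyHom_eq_zero S' orthY fun c q => orthXY v c p q, zero_mul, add_zero]
  have entry₂ : ∀ f (c : Y) p q, (S' c).y p * ψ f * (S' c).x q = (S' c).ev (f.2.1 c p q) := by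
    intro f c p q
    rw [hψ, mul_add, add_mul, MatrixSystem.y_mul_familyHom_mul_x,
      MatrixSystem.mul_familyHom_eq_zero S orthX fun v q => orthYX c v p q, zero_mul, zero_add]
  refine ⟨ψ, ?_, ?_, ?_⟩
  · intro f g hfg
    refine Prod.ext (MatrixSystem.ext_of_ev_eq S fun v p q => ?_)
      (MatrixSystem.ext_of_ev_eq S' fun c p q => ?_)
    · rw [← entry₁, ← entry₁, hfg]
    · rw [← entry₂, ← entry₂, hfg]
  · intro x
    constructor
    · intro hx
      induction hx using Submodule.span_induction with
      | zero => exact ⟨0, map_zero ψ⟩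
      | add x y _ _ hx hy =>
        obtain ⟨f, rfl⟩ := hx
        obtain ⟨g, rfl⟩ := hy
        exact ⟨f + g, map_add ψ f g⟩
      | smul k x _ hx =>
        obtain ⟨f, rfl⟩ := hx
        exact ⟨k • f, map_smul ψ k f⟩
      | mem x hx =>
        obtain ⟨u, l, u', l', w, h, h', hw, rfl⟩ := hx
        -- The range `w` is moved along its tree: to a vertex shared with the line of the
        -- representative, or to the base of the chosen rotation of the cycle it runs into.
        rcases hw.isLinePoint_or with hline | ⟨d, μ₁, hμ₁⟩
        · obtain ⟨v, ⟨hv, x, ⟨μ, hμ⟩, hx⟩, -⟩ := hX.2 w hline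
          obtain ⟨p, q, hpq⟩ := eq_x_mul_ev_mul_y_of_mem_tree K (hX.1 v hv) (hSev ⟨v, hv⟩)
            (hS ⟨v, hv⟩) (h.append hμ) (h'.append hμ) hx
          obtain ⟨f, hf⟩ := MatrixSystem.exists_familyHom_eq S orthX ⟨v, hv⟩ p q 1
          refine ⟨(f, 0), ?_⟩
          rw [pathAux_mul_ghostPathAux_eq_append K h h' hw hμ, hpq, ← hf, hψ, map_zero, add_zero]
        · obtain ⟨c, ⟨hc, hrot⟩, -⟩ := hY d
          obtain ⟨μ₂, hμ₂⟩ := BasedCycleWithoutExits.base_mem_tree hrot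
          have hμ := hμ₁.append hμ₂
          obtain ⟨p, a, q, hpq⟩ := eq_x_mul_ev_mul_y_of_cycle K (hSev' ⟨c, hc⟩) (hSx' ⟨c, hc⟩)
            (hSy' ⟨c, hc⟩) (h.append hμ) (h'.append hμ)
          obtain ⟨f, hf⟩ := MatrixSystem.exists_familyHom_eq S' orthY ⟨c, hc⟩ p q a
          refine ⟨(0, f), ?_⟩
          rw [pathAux_mul_ghostPathAux_eq_append K h h' hw hμ, hpq, ← hf, hψ, map_zero, zero_add]
    · rintro ⟨f, rfl⟩
      have hmem : ∀ {u w : V} {l : List W}, G.IsPath u l w → G.IsStraight w → ∀ b,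
          pathAux K G u l * b ∈ straightIdeal K G := by
        intro u w l h hw b
        rw [← pathAux_mul_vertex K h]
        exact straightIdeal_mul_mem _ (mul_mem_straightIdeal _ (vertex_mem_straightIdeal K G hw))
      refine add_mem (MatrixSystem.familyHom_mem_of_x_mul_mem S orthX (fun v p b => ?_) _)
        (MatrixSystem.familyHom_mem_of_x_mul_mem S' orthY (fun c p b => ?_) _)
      · obtain ⟨τ, hτ, hx, -⟩ := hS v p
        rw [hx, mul_assoc]
        exact hmem p.1.isPath ((hX.1 v v.2).isStraight.of_mem_tree p.2.1) _
      · rw [hSx']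
        refine hmem p.1.isPath ?_ _
        rw [p.2.1]
        exact c.1.2.isStraight
  · intro n f
    constructor
    -- If `ψ f` has degree `n`, then `y p * ψ f * x q` has degree `n + δ q - δ p`, and `ev_mem_iff`
    -- transfers this to the entry.
    · refine fun h => ⟨fun v p q => ?_, fun c p q => ?_⟩
      · rw [← (S v).ev_mem_iff, ← entry₁]
        have := mul_mem_grade (mul_mem_grade ((S v).y_mem p) h) ((S v).x_mem q)
        rwa [show -G.lineShift v p + n + G.lineShift v q =
          n + G.lineShift v q - G.lineShift v p by ring] at this
      · rw [← (S' c).ev_mem_iff, ← entry₂]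
        have := mul_mem_grade (mul_mem_grade ((S' c).y_mem p) h) ((S' c).x_mem q)
        rwa [show -cycleShift c.1 p + n + cycleShift c.1 q =
          n + cycleShift c.1 q - cycleShift c.1 p by ring] at this
    · rintro ⟨h₁, h₂⟩
      exact add_mem (MatrixSystem.familyHom_mem S orthX mul_mem_grade h₁)
        (MatrixSystem.familyHom_mem S' orthY mul_mem_grade h₂)

end DirGraph.LeavittPathAlgebra
end

/-- The graded socle of the Leavitt path algebra of an arbitrary graph. -/
theorem mainTheorem1 {V W K : Type*} [Field K] (G : DirGraph V W) :
    (DirGraph.LeavittPathAlgebra.gradedSocle K G : Set (G.LeavittPathAlgebra K)) =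
        (TwoSidedIdeal.span {x : G.LeavittPathAlgebra K |
          ∃ v : V, (G.IsLinePoint v ∨ G.IsLaurentVertex v) ∧
            x = DirGraph.LeavittPathAlgebra.vertex K G v} : Set (G.LeavittPathAlgebra K)) ∧
      ∀ (X : Set V) (Y : Set G.BasedCycleWithoutExits),
        G.IsLinePointTransversal X → G.IsCycleTransversal Y →
          ∃ φ : DirGraph.LeavittPathAlgebra.gradedSocle K G →ₙₐ[K] G.SocleModel K X Y,
            Function.Bijective φ ∧
              ∀ (n : ℤ) (x : DirGraph.LeavittPathAlgebra.gradedSocle K G),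
                (x : G.LeavittPathAlgebra K) ∈ DirGraph.LeavittPathAlgebra.grade K G n ↔
                  φ x ∈ G.socleModelGrade K X Y n := by
  refine ⟨?_, fun X Y hX hY => ?_⟩
  · rw [← DirGraph.LeavittPathAlgebra.coe_straightIdeal_eq_span]
    exact Set.ext fun x => DirGraph.LeavittPathAlgebra.mem_gradedSocle_iff K G
  · obtain ⟨ψ, hinj, hrange, hgrade⟩ :=
      DirGraph.LeavittPathAlgebra.exists_socleModel_embedding K hX hY
    obtain ⟨φ, hbij, hφ⟩ := NonUnitalAlgHom.exists_inverse_of_injective hinj fun x =>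
      (DirGraph.LeavittPathAlgebra.mem_gradedSocle_iff K G).trans (hrange x)
    refine ⟨φ, hbij, fun n x => ?_⟩
    rw [← hgrade, hφ]
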